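/- Let $\mathbb F\in\{\mathbb R,\mathbb C\}$, and let $f:\mathbb F^{n\times n}\to\mathbb F^{n\times n}$ be a continuous map with $f(f(X))=X$, $f(X+Y)=f(X)+f(Y)$, $f(XY)=f(X)f(Y)$ for all $X,Y$, and $f(X)\ge 0$ whenever $X\ge 0$ (here $\ge$ and $>$ refer to the Loewner order on Hermitian matrices). Let $A\in\mathbb F^{n\times n}$, let $Q\in\mathbb F^{n\times n}$ be Hermitian, and fix one of the signs in $$(\mathrm E_\pm)\quad X\pm A^Hf(X)^{-1}A=Q,\qquad (\mathrm D_\pm)\quad \widetilde X=Q\mp f(A)f(\widetilde X)^{-1}f(A)^H .$$ For the plus sign assume that there is some $X>0$ with $X\le Q-A^Hf(X)^{-1}A$; for the minus sign assume that $Q>0$ and that $A$ is nonsingular. A positive definite solution of $(\mathrm E_\pm)$ or $(\mathrm D_\pm)$ is called maximal if it is $\ge$ every Hermitian solution of that equation. Put $$A^{(1)}=f(A)f(Q)^{-1}A,\quad B^{(1)}=\pm f(A)f(Q)^{-1}f(A)^H,\quad Q^{(1)}=Q\mp A^Hf(Q)^{-1}A,$$ and consider Algorithm 1: for $k\ge 1$,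 $$A^{(k+1)}=A^{(1)}(Q^{(1)}-B^{(k)})^{-1}A^{(k)},\quad B^{(k+1)}=B^{(1)}+A^{(1)}(Q^{(1)}-B^{(k)})^{-1}(A^{(1)})^H,\quad Q^{(k+1)}=Q^{(k)}-(A^{(k)})^H(Q^{(1)}-B^{(k)})^{-1}A^{(k)} .$$ A sequence $U^{(k)}$ converges R-linearly to $U$ if there are $c>0$ and $0<\tau<1$ with $\|U^{(k+1)}-U\|<c\,\tau^k$ for all $k\ge 1$. Let $\sigma$ and $\rho$ denote the spectrum and the spectral radius, formed with all complex eigenvalues. Theorem. The maximal positive definite solution $X_M$ of $(\mathrm E_\pm)$ exists, and so does the maximal positive definite solution of $(\mathrm D_\pm)$, which we write as $Q-Y_M$. The matrices $T_1=(X_M-B^{(1)})^{-1}A^{(1)}$ and $S_1=A^{(1)}(Q^{(1)}-Y_M)^{-1}$ are well defined, and $\sigma(T_1)=\sigma(S_1)$, $\rho(T_1)\le 1$, $\rho(T_1S_1^H)\le 1$. Furthermore: (1) $X_M>Y_M$ if and only if $\rho(T_1)<1$, if and only if $\rho(T_1S_1^H)<1$. (2) For the minus sign, $X_M-Y_M$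 is always positive definite, and $\rho(T_1)<1$. (3) For the plus sign, $X_M-Y_M$ is singular if and only if $\rho(T_1)=1$, if and only if $1\in\sigma(T_1S_1^H)$. Moreover, the dimension of the null space of $X_M-Y_M$ equals the algebraic multiplicity of $1$ as an eigenvalue of $T_1S_1^H$ (which is $0$ if $1$ is not an eigenvalue). (4) Algorithm 1 is well defined, that is, $f(Q)$ and all the matrices $Q^{(1)}-B^{(k)}$ are nonsingular, and $Q^{(k)}\to X_M$, $B^{(k)}\to Y_M$. For every norm on $\mathbb F^{n\times n}$: if $\rho(T_1)<1$, then $A^{(k)}$, $Q^{(k)}$ and $B^{(k)}$ converge R-linearly to $0$, $X_M$ and $Y_M$, respectively; and $$\limsup_{k\to\infty}\sqrt[k]{\|A^{(k)}\|}\le\rho(T_1),\quad \limsup_{k\to\infty}\sqrt[k]{\|Q^{(k)}-X_M\|}\le\rho(T_1)^2,\quad \limsup_{k\to\infty}\sqrt[k]{\|(Q-B^{(k)})-(Q-Y_M)\|}\le\rho(T_1)^2 .$$ -/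

import Mathlib

open scoped Matrix ENNReal ComplexOrder

noncomputable section

namespace NME

variable {𝕜 : Type*} [RCLike 𝕜] {n : Type*} [Fintype n] [DecidableEq n]

/-- The sign in the equations `X + Aᴴ f(X)⁻¹ A = Q` and `X - Aᴴ f(X)⁻¹ A = Q`. -/
inductive Sgn where
  | plus
  | minus

/-- The sign as an integer. -/
def Sgn.val : Sgn → ℤ
  | Sgn.plus => 1
  | Sgn.minus => -1

/-- The assumptions on the matrix operator `f`: period two, additive, multiplicative
(order preserving), and preserving positive semidefiniteness. -/
structure IsAdmissible (f : Matrix n n 𝕜 → Matrix n n 𝕜) : Prop where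
  period_two : ∀ X, f (f X) = X
  map_add : ∀ X Y, f (X + Y) = f X + f Y
  map_mul : ∀ X Y, f (X * Y) = f X * f Y
  map_nonneg : ∀ X : Matrix n n 𝕜, X.PosSemidef → (f X).PosSemidef

/-- `X` is a Hermitian solution of `X ± Aᴴ f(X)⁻¹ A = Q`. -/
def IsSolution (s : Sgn) (f : Matrix n n 𝕜 → Matrix n n 𝕜) (A Q X : Matrix n n 𝕜) : Prop :=
  X.IsHermitian ∧ IsUnit (f X) ∧ X + s.val • (Aᴴ * (f X)⁻¹ * A) = Q

/-- `X` is a Hermitian solution of the dual equation `X = Q ∓ f(A) f(X)⁻¹ f(A)ᴴ`. -/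
def IsDualSolution (s : Sgn) (f : Matrix n n 𝕜 → Matrix n n 𝕜) (A Q X : Matrix n n 𝕜) : Prop :=
  X.IsHermitian ∧ IsUnit (f X) ∧ X = Q - s.val • (f A * (f X)⁻¹ * (f A)ᴴ)

/-- `X` is the maximal positive definite element of a solution set: it is a positive definite
solution, and it dominates every (Hermitian) solution in the Loewner order. -/
def IsMaximalPosDef (sol : Matrix n n 𝕜 → Prop) (X : Matrix n n 𝕜) : Prop :=
  sol X ∧ X.PosDef ∧ ∀ Z, sol Z → (X - Z).PosSemidef

/-- The standing assumption: for the plus sign there is a positive definite `X` with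
`X ≤ Q - Aᴴ f(X)⁻¹ A`; for the minus sign `Q` is positive definite and `A` is nonsingular. -/
def Standing (s : Sgn) (f : Matrix n n 𝕜 → Matrix n n 𝕜) (A Q : Matrix n n 𝕜) : Prop :=
  match s with
  | Sgn.plus => ∃ X : Matrix n n 𝕜, X.PosDef ∧ (Q - Aᴴ * (f X)⁻¹ * A - X).PosSemidef
  | Sgn.minus => Q.PosDef ∧ IsUnit A

/-- A triple `(A⁽ᵏ⁾, B⁽ᵏ⁾, Q⁽ᵏ⁾)` of matrices. -/
structure Triple (𝕜 n : Type*) where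
  A : Matrix n n 𝕜
  B : Matrix n n 𝕜
  Q : Matrix n n 𝕜

/-- The initial triple `(A⁽¹⁾, B⁽¹⁾, Q⁽¹⁾)`. -/
def initial (s : Sgn) (f : Matrix n n 𝕜 → Matrix n n 𝕜) (A Q : Matrix n n 𝕜) : Triple 𝕜 n where
  A := f A * (f Q)⁻¹ * A
  B := s.val • (f A * (f Q)⁻¹ * (f A)ᴴ)
  Q := Q - s.val • (Aᴴ * (f Q)⁻¹ * A)

/-- One step of the fixed point iteration with initial triple `I`. -/
def step (I P : Triple 𝕜 n) : Triple 𝕜 n where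
  A := I.A * (I.Q - P.B)⁻¹ * P.A
  B := I.B + I.A * (I.Q - P.B)⁻¹ * I.Aᴴ
  Q := P.Q - P.Aᴴ * (I.Q - P.B)⁻¹ * P.A

/-- The fixed point iteration. The indices of the iterates start at `1`:
`iter s f A Q k` is the triple `(A⁽ᵏ⁺¹⁾, B⁽ᵏ⁺¹⁾, Q⁽ᵏ⁺¹⁾)`. -/
def iter (s : Sgn) (f : Matrix n n 𝕜 → Matrix n n 𝕜) (A Q : Matrix n n 𝕜) : ℕ → Triple 𝕜 n
  | 0 => initial s f A Q
  | k + 1 => step (initial s f A Q) (iter s f A Q k)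

/-- The matrix `T₁ = (X - B⁽¹⁾)⁻¹ A⁽¹⁾` (used with `X` the maximal solution). -/
def matT (s : Sgn) (f : Matrix n n 𝕜 → Matrix n n 𝕜) (A Q X : Matrix n n 𝕜) : Matrix n n 𝕜 :=
  (X - (initial s f A Q).B)⁻¹ * (initial s f A Q).A

/-- The matrix `S₁ = A⁽¹⁾ (Q⁽¹⁾ - Y)⁻¹` (used with `Q - Y` the maximal dual solution). -/
def matS (s : Sgn) (f : Matrix n n 𝕜 → Matrix n n 𝕜) (A Q Y : Matrix n n 𝕜) : Matrix n n 𝕜 :=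
  (initial s f A Q).A * ((initial s f A Q).Q - Y)⁻¹

/-- The matrix `M` with its entries (in `ℝ` or `ℂ`) regarded as complex numbers. -/
def toComplex (M : Matrix n n 𝕜) : Matrix n n ℂ :=
  M.map fun z => (RCLike.re z : ℂ) + (RCLike.im z : ℂ) * Complex.I

/-- The spectrum, that is, the set of all complex eigenvalues. -/
def spec (M : Matrix n n 𝕜) : Set ℂ := spectrum ℂ (toComplex M)

/-- The spectral radius, that is, the largest modulus of a complex eigenvalue. -/
def specRadius (M : Matrix n n 𝕜) : ℝ≥0∞ := spectralRadius ℂ (toComplex M)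

/-- R-linear convergence to `L` of the sequence `u 0, u 1, u 2, …` whose terms are the
iterates number `1, 2, 3, …`. -/
def RLinear (N : Seminorm 𝕜 (Matrix n n 𝕜)) (u : ℕ → Matrix n n 𝕜) (L : Matrix n n 𝕜) : Prop :=
  ∃ c σ : ℝ, 0 < c ∧ 0 < σ ∧ σ < 1 ∧ ∀ k : ℕ, 1 ≤ k → N (u k - L) < c * σ ^ k

/-- The limes superior, as `k → ∞`, of the `k`-th root of the norm of the `k`-th term, for a
sequence `u 0, u 1, u 2, …` whose terms have the numbers `1, 2, 3, …`. -/
def rootRate (N : Seminorm 𝕜 (Matrix n n 𝕜)) (u : ℕ → Matrix n n 𝕜) : ℝ≥0∞ :=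
  Filter.limsup (fun k : ℕ => ENNReal.ofReal (N (u k) ^ (1 / ((k : ℝ) + 1)))) Filter.atTop

end NME

end

noncomputable section

namespace NME

section Algebra

variable {𝕜 : Type*} [RCLike 𝕜] {n : Type*} [Fintype n] [DecidableEq n]

theorem inv_mul_self {M : Matrix n n 𝕜} (h : IsUnit M) : M⁻¹ * M = 1 :=
  Matrix.nonsing_inv_mul M ((Matrix.isUnit_iff_isUnit_det M).1 h)

theorem mul_inv_self {M : Matrix n n 𝕜} (h : IsUnit M) : M * M⁻¹ = 1 :=
  Matrix.mul_nonsing_inv M ((Matrix.isUnit_iff_isUnit_det M).1 h)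

theorem isUnit_inv {M : Matrix n n 𝕜} (h : IsUnit M) : IsUnit M⁻¹ :=
  Matrix.isUnit_nonsing_inv_iff.2 h

theorem det_schur (P X a b : Matrix n n 𝕜) (hP : IsUnit P) (hX : IsUnit X) :
    X.det * (P - b * X⁻¹ * a).det = P.det * (X - a * P⁻¹ * b).det := by
  have h1 : P - b * X⁻¹ * a = P * (1 - (P⁻¹ * b) * (X⁻¹ * a)) := by
    linear_combination (norm := noncomm_ring) mul_inv_self hP * b * X⁻¹ * a
  have h2 : X - a * P⁻¹ * b = X * (1 - (X⁻¹ * a) * (P⁻¹ * b)) := by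
    linear_combination (norm := noncomm_ring) mul_inv_self hX * a * P⁻¹ * b
  rw [h1, h2, Matrix.det_mul, Matrix.det_mul, Matrix.det_one_sub_mul_comm]
  ring

theorem isUnit_schur {P X a b : Matrix n n 𝕜} (hP : IsUnit P) (hX : IsUnit X)
    (h : IsUnit (X - a * P⁻¹ * b)) : IsUnit (P - b * X⁻¹ * a) := by
  have := det_schur P X a b hP hX
  simp only [Matrix.isUnit_iff_isUnit_det, isUnit_iff_ne_zero] at *
  intro h0
  rw [h0, mul_zero] at this
  exact mul_ne_zero hP h this.symm

/-- The Woodbury identity. -/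
theorem woodbury {P X a b : Matrix n n 𝕜} (hP : IsUnit P) (hX : IsUnit X)
    (h : IsUnit (X - a * P⁻¹ * b)) :
    (P - b * X⁻¹ * a)⁻¹ = P⁻¹ + P⁻¹ * b * (X - a * P⁻¹ * b)⁻¹ * a * P⁻¹ := by
  apply Matrix.inv_eq_right_inv
  have e1 := mul_inv_self hP
  have e2 := inv_mul_self hX
  have e3 := mul_inv_self h
  set E := (X - a * P⁻¹ * b)⁻¹
  linear_combination (norm := noncomm_ring) e1 + e1 * b * E * a * P⁻¹ - b * e2 * E * a * P⁻¹
    + b * X⁻¹ * e3 * a * P⁻¹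

theorem push_through {P X a b : Matrix n n 𝕜} (hP : IsUnit P) (hX : IsUnit X)
    (h : IsUnit (X - a * P⁻¹ * b)) :
    (P - b * X⁻¹ * a)⁻¹ * b * X⁻¹ = P⁻¹ * b * (X - a * P⁻¹ * b)⁻¹ := by
  have h' := isUnit_schur hP hX h
  have e1 := inv_mul_self h'
  have e2 := mul_inv_self h
  have e3 := inv_mul_self hX
  have e4 := mul_inv_self hP
  set E := (X - a * P⁻¹ * b)⁻¹
  set F := (P - b * X⁻¹ * a)⁻¹
  linear_combination (norm := noncomm_ring) e1 * P⁻¹ * b * E - F * b * X⁻¹ * e2 - F * e4 * b * E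
    + F * b * e3 * E 

end Algebra

section Order

variable {𝕜 : Type*} [RCLike 𝕜] {n : Type*} [Fintype n] [DecidableEq n]

theorem schur_posSemidef {P X b : Matrix n n 𝕜} (hP : P.PosDef) (hX : X.PosDef) :
    (P - bᴴ * X⁻¹ * b).PosSemidef ↔ (X - b * P⁻¹ * bᴴ).PosSemidef := by
  have := hP.isUnit.invertible
  have := hX.isUnit.invertible
  rw [← Matrix.PosDef.fromBlocks₁₁ b P hX, ← Matrix.PosDef.fromBlocks₂₂ X b hP]

theorem schur_posDef {P X b : Matrix n n 𝕜} (hP : P.PosDef) (hX : X.PosDef)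
    (h : (X - b * P⁻¹ * bᴴ).PosDef) : (P - bᴴ * X⁻¹ * b).PosDef :=
  ((schur_posSemidef hP hX).2 h.posSemidef).posDef_iff_isUnit.2
    (isUnit_schur hP.isUnit hX.isUnit h.isUnit)

theorem schur_posDef' {P X b : Matrix n n 𝕜} (hP : P.PosDef) (hX : X.PosDef)
    (h : (X - bᴴ * P⁻¹ * b).PosDef) : (P - b * X⁻¹ * bᴴ).PosDef := by
  have := schur_posDef (b := bᴴ) hP hX (by simpa using h)
  simpa using this

omit [Fintype n] [DecidableEq n] in
theorem posDef_of_le {V Z : Matrix n n 𝕜} (hV : V.PosDef) (h : (Z - V).PosSemidef) :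
    Z.PosDef := by simpa using hV.add_posSemidef h

omit [Fintype n] [DecidableEq n] in
theorem posSemidef_trans {U V Z : Matrix n n 𝕜} (h : (Z - V).PosSemidef)
    (h' : (V - U).PosSemidef) : (Z - U).PosSemidef := by
  simpa using h.add h'

theorem inv_antitone {V Z : Matrix n n 𝕜} (hV : V.PosDef) (h : (Z - V).PosSemidef) :
    (V⁻¹ - Z⁻¹).PosSemidef := by
  have hZ := posDef_of_le hV h
  have := (schur_posSemidef (P := V⁻¹) (X := Z) (b := 1) hV.inv hZ).2 (by
    simpa [Matrix.nonsing_inv_nonsing_inv V ((Matrix.isUnit_iff_isUnit_det V).1 hV.isUnit)] using h)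
  simpa using this

theorem conj_inv_antitone {V Z : Matrix n n 𝕜} (C : Matrix n n 𝕜) (hV : V.PosDef)
    (h : (Z - V).PosSemidef) : (Cᴴ * V⁻¹ * C - Cᴴ * Z⁻¹ * C).PosSemidef := by
  have := (inv_antitone hV h).conjTranspose_mul_mul_same C
  simpa [mul_sub, sub_mul] using this

theorem tendsto_inv {ι : Type*} {l : Filter ι} {u : ι → Matrix n n 𝕜} {U : Matrix n n 𝕜}
    (hU : IsUnit U) (h : Filter.Tendsto u l (nhds U)) :
    Filter.Tendsto (fun i => (u i)⁻¹) l (nhds U⁻¹) := by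
  have hd : U.det ≠ 0 := by
    simpa [isUnit_iff_ne_zero] using (Matrix.isUnit_iff_isUnit_det U).1 hU
  refine (continuousAt_matrix_inv U ?_).tendsto.comp h
  simpa [Ring.inverse_eq_inv'] using continuousAt_inv₀ hd

omit [DecidableEq n] in
theorem isClosed_posSemidef : IsClosed {M : Matrix n n 𝕜 | M.PosSemidef} := by
  have : {M : Matrix n n 𝕜 | M.PosSemidef} = {M : Matrix n n 𝕜 | Mᴴ = M} ∩
      ⋂ x : n → 𝕜, {M : Matrix n n 𝕜 | 0 ≤ star x ⬝ᵥ (M *ᵥ x)} := by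
    ext M
    simp [Matrix.posSemidef_iff_dotProduct_mulVec, Matrix.IsHermitian]
  rw [this]
  refine (isClosed_eq (Continuous.matrix_conjTranspose continuous_id) continuous_id).inter
    (isClosed_iInter fun x => isClosed_le continuous_const ?_)
  exact Continuous.dotProduct continuous_const (Continuous.matrix_mulVec continuous_id continuous_const)

omit [DecidableEq n] in
theorem posSemidef_of_tendsto {u : ℕ → Matrix n n 𝕜} {U : Matrix n n 𝕜}
    (h : Filter.Tendsto u Filter.atTop (nhds U)) (hu : ∀ k, (u k).PosSemidef) : U.PosSemidef :=
  isClosed_posSemidef.mem_of_tendsto h (Filter.Eventually.of_forall hu)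

/-- The modulus of an entry of a positive semidefinite matrix is at most the trace. -/
theorem norm_entry_le_trace {M : Matrix n n 𝕜} (hM : M.PosSemidef) (i j : n) :
    ‖M i j‖ ≤ RCLike.re M.trace := by
  obtain ⟨c, hc, hcM⟩ := RCLike.exists_norm_eq_mul_self (M i j)
  have hdiag : ∀ i, RCLike.re (M i i) ≤ RCLike.re M.trace := by
    intro i
    rw [Matrix.trace, map_sum]
    exact Finset.single_le_sum (f := fun i => RCLike.re (M i i))
      (fun k _ => (RCLike.le_iff_re_im.1 (hM.diag_nonneg (i := k))).1.trans' (by simp))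
      (Finset.mem_univ i)
  have hq := hM.dotProduct_mulVec_nonneg (Pi.single i 1 - c • Pi.single j 1)
  have hji : M j i = star (M i j) := (hM.isHermitian.apply j i).symm
  have hcc : star c * c = 1 := by
    rw [RCLike.star_def, RCLike.conj_mul, hc]; simp
  have hexp : star (Pi.single i 1 - c • Pi.single j 1 : n → 𝕜) ⬝ᵥ
      (M *ᵥ (Pi.single i 1 - c • Pi.single j 1)) =
      M i i + M j j - (c * M i j) - star (c * M i j) := by
    simp only [star_sub, star_smul, Matrix.mulVec_sub, Matrix.mulVec_smul, sub_dotProduct,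
      dotProduct_sub, smul_dotProduct, dotProduct_smul, smul_eq_mul]
    simp only [← Pi.single_star, star_one, Matrix.mulVec_single_one, single_dotProduct,
      Matrix.col_apply, one_mul, star_mul, hji]
    linear_combination (M j j) * hcc
  rw [hexp, ← hcM] at hq
  have h2 := (RCLike.le_iff_re_im.1 hq).1
  simp at h2
  have := hdiag i
  have := hdiag j
  linarith

/-- A decreasing sequence of matrices that is bounded below converges. -/
theorem exists_tendsto_of_antitone {u : ℕ → Matrix n n 𝕜} {L : Matrix n n 𝕜}
    (hu : ∀ k, (u k - u (k + 1)).PosSemidef) (hL : ∀ k, (u k - L).PosSemidef) :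
    ∃ U, Filter.Tendsto u Filter.atTop (nhds U) := by
  have hmono : ∀ k l, k ≤ l → (u k - u l).PosSemidef := by
    intro k l hkl
    induction l, hkl using Nat.le_induction with
    | base => simpa using Matrix.PosSemidef.zero
    | succ l _ ih => exact posSemidef_trans ih (hu l)
  have hre : ∀ {M : Matrix n n 𝕜}, M.PosSemidef → 0 ≤ RCLike.re M.trace := fun h =>
    (RCLike.le_iff_re_im.1 h.trace_nonneg).1.trans' (by simp)
  have htr : ∃ t, Filter.Tendsto (fun k => RCLike.re (u k).trace) Filter.atTop (nhds t) := by
    refine ⟨_, tendsto_atTop_ciInf ?_ ?_⟩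
    · intro k l hkl
      have := hre (hmono k l hkl)
      simpa [Matrix.trace_sub] using this
    · refine ⟨RCLike.re L.trace, ?_⟩
      rintro _ ⟨k, rfl⟩
      have := hre (hL k)
      simpa [Matrix.trace_sub] using this
  obtain ⟨t, ht⟩ := htr
  have hc : CauchySeq (fun k => RCLike.re (u k).trace) := ht.cauchySeq
  have : ∀ i j, ∃ c, Filter.Tendsto (fun k => u k i j) Filter.atTop (nhds c) := by
    intro i j
    refine cauchySeq_tendsto_of_complete ?_
    rw [Metric.cauchySeq_iff'] at hc ⊢
    intro ε hε
    obtain ⟨N, hN⟩ := hc ε hε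
    refine ⟨N, fun k hk => lt_of_le_of_lt ?_ (hN k hk)⟩
    have := norm_entry_le_trace (hmono N k hk) i j
    rw [dist_comm, dist_eq_norm, dist_comm, Real.dist_eq]
    refine le_trans ?_ (this.trans ?_)
    · simp
    · rw [Matrix.trace_sub, map_sub]; exact le_abs_self _
  choose U hU using this
  exact ⟨Matrix.of U, tendsto_pi_nhds.2 fun i => tendsto_pi_nhds.2 fun j => hU i j⟩

end Order

section Complexification

variable {𝕜 : Type*} [RCLike 𝕜] {n : Type*} [Fintype n] [DecidableEq n]

/-- The embedding of `ℝ` or `ℂ` into `ℂ`. -/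
def embC (𝕜 : Type*) [RCLike 𝕜] : 𝕜 →+* ℂ where
  toFun z := (RCLike.re z : ℂ) + (RCLike.im z : ℂ) * Complex.I
  map_one' := by simp
  map_zero' := by simp
  map_add' x y := by simp; ring
  map_mul' x y := by apply Complex.ext <;> simp

theorem embC_apply (z : 𝕜) : embC 𝕜 z = (RCLike.re z : ℂ) + (RCLike.im z : ℂ) * Complex.I := rfl

theorem embC_star (z : 𝕜) : embC 𝕜 (star z) = star (embC 𝕜 z) := by
  apply Complex.ext <;> simp [embC_apply]

theorem embC_nonneg_iff (z : 𝕜) : 0 ≤ embC 𝕜 z ↔ 0 ≤ z := by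
  rw [RCLike.nonneg_iff (z := z), Complex.nonneg_iff]
  simp [embC_apply, eq_comm]

theorem norm_embC (z : 𝕜) : ‖embC 𝕜 z‖ = ‖z‖ := by
  rw [← sq_eq_sq₀ (norm_nonneg _) (norm_nonneg _), ← RCLike.normSq_eq_def', ← RCLike.normSq_eq_def',
    RCLike.normSq_apply, RCLike.normSq_apply]
  simp [embC_apply]

theorem continuous_embC : Continuous (embC 𝕜) := by
  change Continuous fun z : 𝕜 => (RCLike.re z : ℂ) + (RCLike.im z : ℂ) * Complex.I
  fun_prop

theorem toComplex_eq (M : Matrix n n 𝕜) : toComplex M = (embC 𝕜).mapMatrix M := rfl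

theorem toComplex_mul (M N : Matrix n n 𝕜) : toComplex (M * N) = toComplex M * toComplex N := by
  simp only [toComplex_eq, map_mul]

theorem toComplex_sub (M N : Matrix n n 𝕜) : toComplex (M - N) = toComplex M - toComplex N := by
  simp only [toComplex_eq, map_sub]

theorem toComplex_add (M N : Matrix n n 𝕜) : toComplex (M + N) = toComplex M + toComplex N := by
  simp only [toComplex_eq, map_add]

theorem toComplex_one : toComplex (1 : Matrix n n 𝕜) = 1 := by
  simp only [toComplex_eq, map_one]

theorem toComplex_pow (M : Matrix n n 𝕜) (k : ℕ) : toComplex (M ^ k) = toComplex M ^ k := by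
  simp only [toComplex_eq, map_pow]

omit [Fintype n] [DecidableEq n] in
theorem toComplex_conjTranspose (M : Matrix n n 𝕜) : toComplex Mᴴ = (toComplex M)ᴴ := by
  ext i j
  exact embC_star (M j i)

theorem isUnit_toComplex {M : Matrix n n 𝕜} : IsUnit (toComplex M) ↔ IsUnit M := by
  rw [Matrix.isUnit_iff_isUnit_det, Matrix.isUnit_iff_isUnit_det, toComplex_eq, ← RingHom.map_det]
  simp [isUnit_iff_ne_zero]

theorem toComplex_inv {M : Matrix n n 𝕜} (h : IsUnit M) : toComplex M⁻¹ = (toComplex M)⁻¹ := by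
  symm
  apply Matrix.inv_eq_right_inv
  rw [← toComplex_mul, mul_inv_self h, toComplex_one]

omit [Fintype n] [DecidableEq n] in
theorem continuous_toComplex : Continuous (toComplex : Matrix n n 𝕜 → Matrix n n ℂ) :=
  Continuous.matrix_map continuous_id continuous_embC

open scoped MatrixOrder Matrix.Norms.L2Operator in
theorem exists_eq_conjTranspose_mul_self {M : Matrix n n 𝕜} (h : M.PosSemidef) :
    ∃ B : Matrix n n 𝕜, M = Bᴴ * B :=
  CStarAlgebra.nonneg_iff_eq_star_mul_self.mp h.nonneg

theorem posSemidef_toComplex {M : Matrix n n 𝕜} : (toComplex M).PosSemidef ↔ M.PosSemidef := by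
  constructor
  · intro h
    refine Matrix.PosSemidef.of_dotProduct_mulVec_nonneg ?_ fun x => ?_
    · have h1 := h.isHermitian
      ext i j
      have := congrFun (congrFun h1 i) j
      rw [← toComplex_conjTranspose] at this
      exact (embC 𝕜).injective this
    · have := h.dotProduct_mulVec_nonneg (embC 𝕜 ∘ x)
      rw [← embC_nonneg_iff]
      convert this using 1
      rw [RingHom.map_dotProduct, toComplex_eq, RingHom.mapMatrix_apply]
      congr 1
      · ext i; exact embC_star (x i)
      · ext i; exact RingHom.map_mulVec _ _ _ _
  · intro h
    obtain ⟨B, rfl⟩ := exists_eq_conjTranspose_mul_self h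
    rw [toComplex_mul, toComplex_conjTranspose]
    exact Matrix.posSemidef_conjTranspose_mul_self _

theorem posDef_toComplex {M : Matrix n n 𝕜} : (toComplex M).PosDef ↔ M.PosDef := by
  constructor <;> intro h
  · exact (posSemidef_toComplex.1 h.posSemidef).posDef_iff_isUnit.2 (isUnit_toComplex.1 h.isUnit)
  · exact (posSemidef_toComplex.2 h.posSemidef).posDef_iff_isUnit.2 (isUnit_toComplex.2 h.isUnit)

end Complexification

section Solutions

variable {𝕜 : Type*} [RCLike 𝕜] {n : Type*} [Fintype n] [DecidableEq n]

theorem posDef_of_solution_of_isUnit_add {C R V Z : Matrix n n 𝕜} (hV : V.PosDef)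
    (hsub : (R - Cᴴ * V⁻¹ * C - V).PosSemidef) (hZ : Z.IsHermitian) (hZu : IsUnit Z)
    (hsol : R - Cᴴ * Z⁻¹ * C = Z) (hu : IsUnit (Z + C)) : Z.PosDef := by
  have h1 : ((Z + C)ᴴ * Z⁻¹ * (Z + C)).PosSemidef := by
    have h2 := hsub.add (hV.inv.posSemidef.conjTranspose_mul_mul_same (V + C))
    convert h2 using 1
    rw [Matrix.conjTranspose_add, Matrix.conjTranspose_add, hZ.eq, hV.isHermitian.eq]
    have e1 := mul_inv_self hZu
    have e2 := inv_mul_self hZu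
    have e3 := mul_inv_self hV.isUnit
    have e4 := inv_mul_self hV.isUnit
    linear_combination (norm := noncomm_ring) e1 * (Z + C) - e3 * (V + C) + Cᴴ * e2 - Cᴴ * e4 - hsol
  have h3 : Z⁻¹.PosSemidef := by
    have := (Matrix.IsUnit.posSemidef_star_left_conjugate_iff (x := Z⁻¹) hu).1 h1
    exact this
  have h4 : Z⁻¹.PosDef := h3.posDef_iff_isUnit.2 (isUnit_inv hZu)
  exact Matrix.posDef_inv_iff.1 h4

theorem exists_norm_eq_one_notMem_spectrum (M : Matrix n n ℂ) :
    ∃ μ : ℂ, ‖μ‖ = 1 ∧ μ ∉ spectrum ℂ M := by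
  by_contra! h
  have hfin : (Metric.sphere (0 : ℂ) 1).Finite :=
    (Matrix.finite_spectrum M).subset fun μ hμ => h μ (by simpa using hμ)
  refine (isPreconnected_sphere (by simp) (0 : ℂ) 1).infinite_of_nontrivial ?_ hfin
  exact ⟨1, by simp, -1, by simp, by norm_num⟩

/-- Every Hermitian solution is positive definite as soon as there is a positive definite
subsolution. -/
theorem posDef_of_solution {C R V Z : Matrix n n 𝕜} (hV : V.PosDef)
    (hsub : (R - Cᴴ * V⁻¹ * C - V).PosSemidef) (hZ : Z.IsHermitian) (hZu : IsUnit Z)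
    (hsol : R - Cᴴ * Z⁻¹ * C = Z) : Z.PosDef := by
  rw [← posDef_toComplex]
  obtain ⟨μ, hμ, hμs⟩ := exists_norm_eq_one_notMem_spectrum (toComplex (Z⁻¹ * C))
  have hμμ : star μ * μ = 1 := by
    rw [Complex.star_def, Complex.conj_mul', hμ]; simp
  have hrot : ∀ M : Matrix n n ℂ, (-star μ • toComplex C)ᴴ * M * (-star μ • toComplex C) =
      (toComplex C)ᴴ * M * toComplex C := by
    intro M
    rw [Matrix.conjTranspose_smul, Matrix.smul_mul, Matrix.smul_mul, Matrix.mul_smul, smul_smul,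
      mul_comm]
    rw [star_neg, star_star, neg_mul_neg, hμμ, one_smul]
  have hZu' := isUnit_toComplex.2 hZu
  refine posDef_of_solution_of_isUnit_add (C := -star μ • toComplex C) (R := toComplex R)
    (V := toComplex V) (posDef_toComplex.2 hV) ?_ ?_ hZu' ?_ ?_
  · rw [hrot, ← toComplex_inv hV.isUnit, ← toComplex_conjTranspose]
    simpa only [← toComplex_mul, ← toComplex_sub, posSemidef_toComplex] using hsub
  · rw [Matrix.IsHermitian, ← toComplex_conjTranspose, hZ.eq]
  · rw [hrot, ← toComplex_inv hZu, ← toComplex_conjTranspose]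
    simp only [← toComplex_mul, ← toComplex_sub, hsol]
  · have h1 : IsUnit (algebraMap ℂ _ μ - toComplex (Z⁻¹ * C)) := spectrum.notMem_iff.1 hμs
    have h2 : toComplex Z + -star μ • toComplex C =
        star μ • (toComplex Z * (algebraMap ℂ _ μ - toComplex (Z⁻¹ * C))) := by
      rw [mul_sub, ← toComplex_mul, ← mul_assoc, mul_inv_self hZu, one_mul,
        Algebra.algebraMap_eq_smul_one, Matrix.mul_smul, mul_one, smul_sub, smul_smul, hμμ, one_smul,
        neg_smul, sub_eq_add_neg]
    have h0 : star μ ≠ 0 := left_ne_zero_of_mul_eq_one hμμ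
    rw [h2]
    exact (hZu'.mul h1).smul (Units.mk0 _ h0)

/-- The fixed point iteration for `Z + Cᴴ Z⁻¹ C = R`, started with `R`. -/
def fpi (C R : Matrix n n 𝕜) : ℕ → Matrix n n 𝕜
  | 0 => R
  | k + 1 => R - Cᴴ * (fpi C R k)⁻¹ * C

theorem fpi_sub_posSemidef {C R V : Matrix n n 𝕜} (hV : V.PosDef)
    (hsub : (R - Cᴴ * V⁻¹ * C - V).PosSemidef) (k : ℕ) : (fpi C R k - V).PosSemidef := by
  induction k with
  | zero =>
    have := hsub.add (hV.inv.posSemidef.conjTranspose_mul_mul_same C)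
    convert this using 1
    simp only [fpi]; abel
  | succ k ih =>
    have := hsub.add (conj_inv_antitone C hV ih)
    convert this using 1
    simp only [fpi]; abel

/-- Existence of the maximal solution of the reduced equation. -/
theorem exists_maximal_solution {C R V : Matrix n n 𝕜} (hV : V.PosDef)
    (hsub : (R - Cᴴ * V⁻¹ * C - V).PosSemidef) :
    ∃ Z : Matrix n n 𝕜, Z.PosDef ∧ R - Cᴴ * Z⁻¹ * C = Z ∧
      Filter.Tendsto (fpi C R) Filter.atTop (nhds Z) := by
  have hge := fpi_sub_posSemidef hV hsub
  have hpos : ∀ k, (fpi C R k).PosDef := fun k => posDef_of_le hV (hge k)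
  have hanti : ∀ k, (fpi C R k - fpi C R (k + 1)).PosSemidef := by
    intro k
    induction k with
    | zero =>
      have := (hpos 0).inv.posSemidef.conjTranspose_mul_mul_same C
      simpa [fpi] using this
    | succ k ih =>
      have := conj_inv_antitone C (hpos (k + 1)) ih
      convert this using 1
      conv_lhs => rw [fpi, fpi]
      abel
  obtain ⟨Z, hZ⟩ := exists_tendsto_of_antitone hanti hge
  have hZV : (Z - V).PosSemidef := posSemidef_of_tendsto (hZ.sub_const V) hge
  have hZp := posDef_of_le hV hZV
  refine ⟨Z, hZp, ?_, hZ⟩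
  have h1 : Filter.Tendsto (fun k => R - Cᴴ * (fpi C R k)⁻¹ * C) Filter.atTop
      (nhds (R - Cᴴ * Z⁻¹ * C)) :=
    tendsto_const_nhds.sub ((tendsto_const_nhds.mul (tendsto_inv hZp.isUnit hZ)).mul
      tendsto_const_nhds)
  exact tendsto_nhds_unique h1 (hZ.comp (Filter.tendsto_add_atTop_nat 1))

theorem sub_posSemidef_of_subsolution {C R V Z : Matrix n n 𝕜} (hV : V.PosDef)
    (hsub : (R - Cᴴ * V⁻¹ * C - V).PosSemidef)
    (hZ : Filter.Tendsto (fpi C R) Filter.atTop (nhds Z)) : (Z - V).PosSemidef :=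
  posSemidef_of_tendsto (hZ.sub_const V) (fpi_sub_posSemidef hV hsub)

theorem sub_posSemidef_of_solution {C R V Z : Matrix n n 𝕜} (hV : V.IsHermitian) (hVu : IsUnit V)
    (hsol : R - Cᴴ * V⁻¹ * C = V) (hZp : Z.PosDef) (hZs : R - Cᴴ * Z⁻¹ * C = Z)
    (hZ : Filter.Tendsto (fpi C R) Filter.atTop (nhds Z)) : (Z - V).PosSemidef := by
  have hVp : V.PosDef := posDef_of_solution hZp (by simp [hZs, Matrix.PosSemidef.zero]) hV hVu hsol
  exact sub_posSemidef_of_subsolution hVp (by simp [hsol, Matrix.PosSemidef.zero]) hZ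

end Solutions

section Coupled

variable {𝕜 : Type*} [RCLike 𝕜] {n : Type*} [Fintype n] [DecidableEq n]

/-- The off-diagonal part of the coupled iteration. -/
def coup (C R : Matrix n n 𝕜) : ℕ → Matrix n n 𝕜
  | 0 => C
  | k + 1 => C * (fpi Cᴴ R k)⁻¹ * coup C R k

/-- The two fixed point iterations for `C` and `Cᴴ` are coupled by `coup`. -/
theorem coupled {C R : Matrix n n 𝕜} (hz : ∀ k, (fpi C R k).PosDef)
    (hw : ∀ k, (fpi Cᴴ R k).PosDef) (k : ℕ) :
    coup C R (k + 1) = coup C R k * (fpi C R k)⁻¹ * C ∧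
    fpi C R (k + 1) = fpi C R k - (coup C R k)ᴴ * (fpi Cᴴ R k)⁻¹ * coup C R k ∧
    fpi Cᴴ R (k + 1) = fpi Cᴴ R k - coup C R k * (fpi C R k)⁻¹ * (coup C R k)ᴴ := by
  induction k with
  | zero => simp [coup, fpi]
  | succ k ih =>
    obtain ⟨h1, h2, h3⟩ := ih
    have hz0 := (hz k).isUnit
    have hw0 := (hw k).isUnit
    have hz1 := (hz (k + 1)).isUnit
    have hw1 := (hw (k + 1)).isUnit
    have hzh := (hz k).inv.isHermitian.eq
    have hwh := (hw k).inv.isHermitian.eq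
    have hd1 : coup C R (k + 1) = C * (fpi Cᴴ R k)⁻¹ * coup C R k := rfl
    have c1 : (coup C R (k + 1))ᴴ = Cᴴ * (fpi C R k)⁻¹ * (coup C R k)ᴴ := by
      rw [h1, Matrix.conjTranspose_mul, Matrix.conjTranspose_mul, hzh, mul_assoc]
    have c2 : (coup C R (k + 1))ᴴ = (coup C R k)ᴴ * (fpi Cᴴ R k)⁻¹ * Cᴴ := by
      rw [hd1, Matrix.conjTranspose_mul, Matrix.conjTranspose_mul, hwh, mul_assoc]
    refine ⟨?_, ?_, ?_⟩
    · have e : coup C R (k + 1 + 1) = C * (fpi Cᴴ R (k + 1))⁻¹ * coup C R (k + 1) := rfl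
      have hp := push_through hw0 hz0 (h2 ▸ hz1)
      rw [← h3, ← h2] at hp
      rw [e]
      nth_rw 1 [h1]
      rw [hd1]
      linear_combination (norm := noncomm_ring) C * hp * C
    · have e : fpi C R (k + 1 + 1) = R - Cᴴ * (fpi C R (k + 1))⁻¹ * C := rfl
      have e' : fpi C R (k + 1) = R - Cᴴ * (fpi C R k)⁻¹ * C := rfl
      have hp := woodbury hz0 hw0 (h3 ▸ hw1)
      rw [← h3, ← h2] at hp
      rw [e, hp, c1, h1]
      linear_combination (norm := noncomm_ring) -e'
    · have e : fpi Cᴴ R (k + 1 + 1) = R - Cᴴᴴ * (fpi Cᴴ R (k + 1))⁻¹ * Cᴴ := rfl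
      have e' : fpi Cᴴ R (k + 1) = R - Cᴴᴴ * (fpi Cᴴ R k)⁻¹ * Cᴴ := rfl
      have hp := woodbury hw0 hz0 (h2 ▸ hz1)
      rw [← h3, ← h2] at hp
      rw [e, hp, c2, hd1]
      rw [Matrix.conjTranspose_conjTranspose] at e' ⊢
      linear_combination (norm := noncomm_ring) -e'

theorem det_fpi_eq {C R : Matrix n n 𝕜} (hz : ∀ k, (fpi C R k).PosDef)
    (hw : ∀ k, (fpi Cᴴ R k).PosDef) (k : ℕ) : (fpi Cᴴ R k).det = (fpi C R k).det := by
  induction k with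
  | zero => rfl
  | succ k ih =>
    obtain ⟨-, h2, h3⟩ := coupled hz hw k
    have := det_schur (fpi C R k) (fpi Cᴴ R k) (coup C R k) (coup C R k)ᴴ (hz k).isUnit
      (hw k).isUnit
    rw [← h2, ← h3, ih] at this
    exact (mul_left_cancel₀ (hz k).det_pos.ne' this).symm

theorem fpi_dual_sub_posDef {C R Z : Matrix n n 𝕜} (hZ : Z.PosDef)
    (hs : R - Cᴴ * Z⁻¹ * C = Z) (k : ℕ) : (fpi Cᴴ R k + Z - R).PosDef := by
  have hP : (Cᴴ * Z⁻¹ * C).PosSemidef := hZ.inv.posSemidef.conjTranspose_mul_mul_same C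
  induction k with
  | zero => simpa [fpi] using hZ
  | succ k ih =>
    have e : fpi Cᴴ R k + Z - R = fpi Cᴴ R k - Cᴴ * Z⁻¹ * C := by
      linear_combination (norm := noncomm_ring) -hs
    rw [e] at ih
    have hw : (fpi Cᴴ R k).PosDef := by simpa using ih.add_posSemidef hP
    have := schur_posDef' hZ hw ih
    convert this using 1
    rw [fpi, Matrix.conjTranspose_conjTranspose]
    abel

theorem fpi_dual_posDef {C R Z : Matrix n n 𝕜} (hZ : Z.PosDef)
    (hs : R - Cᴴ * Z⁻¹ * C = Z) (k : ℕ) : (fpi Cᴴ R k).PosDef := by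
  have h := (fpi_dual_sub_posDef hZ hs k).add_posSemidef
    (hZ.inv.posSemidef.conjTranspose_mul_mul_same C)
  convert h using 1
  linear_combination (norm := noncomm_ring) hs

/-- If the reduced equation has a positive definite solution, so has its dual. -/
theorem exists_dual_solution {C R Z : Matrix n n 𝕜} (hZ : Z.PosDef)
    (hs : R - Cᴴ * Z⁻¹ * C = Z) (hlim : Filter.Tendsto (fpi C R) Filter.atTop (nhds Z)) :
    ∃ W : Matrix n n 𝕜, W.PosDef ∧ R - C * W⁻¹ * Cᴴ = W ∧
      Filter.Tendsto (fpi Cᴴ R) Filter.atTop (nhds W) := by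
  have hz : ∀ k, (fpi C R k).PosDef := fun k =>
    posDef_of_le hZ (fpi_sub_posSemidef hZ (by simp [hs, Matrix.PosSemidef.zero]) k)
  have hw := fpi_dual_posDef hZ hs
  have hanti : ∀ k, (fpi Cᴴ R k - fpi Cᴴ R (k + 1)).PosSemidef := by
    intro k
    rw [(coupled hz hw k).2.2]
    simpa using (hz k).inv.posSemidef.mul_mul_conjTranspose_same (coup C R k)
  obtain ⟨W, hW⟩ := exists_tendsto_of_antitone (L := 0) hanti (fun k => by
    simpa using (hw k).posSemidef)
  have hWd : W.det = Z.det := by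
    refine tendsto_nhds_unique (f := fun k => (fpi Cᴴ R k).det) (l := Filter.atTop) ?_ ?_
    · exact (Continuous.matrix_det continuous_id).continuousAt.tendsto.comp hW
    · simp only [det_fpi_eq hz hw]
      exact (Continuous.matrix_det continuous_id).continuousAt.tendsto.comp hlim
  have hWp : W.PosDef :=
    (posSemidef_of_tendsto hW fun k => (hw k).posSemidef).posDef_iff_det_ne_zero.2
      (hWd ▸ hZ.det_pos.ne')
  refine ⟨W, hWp, ?_, hW⟩
  have h1 : Filter.Tendsto (fun k => R - C * (fpi Cᴴ R k)⁻¹ * Cᴴ) Filter.atTop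
      (nhds (R - C * W⁻¹ * Cᴴ)) :=
    tendsto_const_nhds.sub ((tendsto_const_nhds.mul (tendsto_inv hWp.isUnit hW)).mul
      tendsto_const_nhds)
  refine tendsto_nhds_unique h1 ?_
  have := hW.comp (Filter.tendsto_add_atTop_nat 1)
  simpa [Function.comp_def, fpi] using this

theorem coup_eq {C R Z : Matrix n n 𝕜} (hZ : Z.PosDef) (hs : R - Cᴴ * Z⁻¹ * C = Z) (k : ℕ) :
    coup C R k = (fpi Cᴴ R k + Z - R) * (Z⁻¹ * C) ^ (k + 1) := by
  have e1 := mul_inv_self hZ.isUnit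
  induction k with
  | zero =>
    simp only [coup, fpi, zero_add, pow_one]
    linear_combination (norm := noncomm_ring) -e1 * C
  | succ k ih =>
    have e2 := inv_mul_self (fpi_dual_posDef hZ hs k).isUnit
    have key : C * (fpi Cᴴ R k)⁻¹ * (fpi Cᴴ R k + Z - R) =
        (R - Cᴴᴴ * (fpi Cᴴ R k)⁻¹ * Cᴴ + Z - R) * (Z⁻¹ * C) := by
      rw [Matrix.conjTranspose_conjTranspose]
      linear_combination (norm := noncomm_ring) C * e2 - C * (fpi Cᴴ R k)⁻¹ * hs - e1 * C
    rw [coup, ih, ← mul_assoc, key, pow_succ' _ (k + 1), fpi]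
    noncomm_ring

theorem fpi_sub_eq {C R Z : Matrix n n 𝕜} (hZ : Z.PosDef) (hs : R - Cᴴ * Z⁻¹ * C = Z)
    (hz : ∀ k, (fpi C R k).PosDef) (k : ℕ) :
    fpi C R k - Z = ((Z⁻¹ * C) ^ (k + 1))ᴴ * (fpi Cᴴ R k + Z - R) * (Z⁻¹ * C) ^ (k + 1) := by
  have e1 := mul_inv_self hZ.isUnit
  have e1' := inv_mul_self hZ.isUnit
  have hZh := hZ.inv.isHermitian.eq
  induction k with
  | zero =>
    simp only [fpi, zero_add, pow_one, Matrix.conjTranspose_mul, hZh]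
    linear_combination (norm := noncomm_ring) hs - Cᴴ * e1' * Z⁻¹ * C
  | succ k ih =>
    have hw := fpi_dual_posDef hZ hs
    have hD := fpi_dual_sub_posDef hZ hs k
    have e2 := inv_mul_self (hw k).isUnit
    have e3 := mul_inv_self (hw k).isUnit
    have key : (fpi Cᴴ R k + Z - R) - (fpi Cᴴ R k + Z - R) * (fpi Cᴴ R k)⁻¹ *
        (fpi Cᴴ R k + Z - R) =
        (Cᴴ * Z⁻¹) * (R - C * (fpi Cᴴ R k)⁻¹ * Cᴴ + Z - R) * (Z⁻¹ * C) := by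
      generalize (fpi Cᴴ R k) = w at *
      obtain rfl : R = Z + Cᴴ * Z⁻¹ * C := by linear_combination (norm := noncomm_ring) hs
      linear_combination (norm := noncomm_ring) -e3 * w + e3 * Cᴴ * Z⁻¹ * C + Cᴴ * Z⁻¹ * C * e2
        - Cᴴ * e1' * Z⁻¹ * C
    rw [(coupled hz hw k).2.1, coup_eq hZ hs, Matrix.conjTranspose_mul, hD.isHermitian.eq, fpi,
      Matrix.conjTranspose_conjTranspose, pow_succ' _ (k + 1), Matrix.conjTranspose_mul,
      Matrix.conjTranspose_mul (Z⁻¹) C, hZh]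
    linear_combination (norm := noncomm_ring) ih +
      ((Z⁻¹ * C) ^ (k + 1))ᴴ * key * (Z⁻¹ * C) ^ (k + 1)

theorem fpi_dual_sub_inv {C R Z : Matrix n n 𝕜} (hZ : Z.PosDef) (hs : R - Cᴴ * Z⁻¹ * C = Z)
    (k : ℕ) : (fpi Cᴴ R (k + 1) + Z - R)⁻¹ =
      Z⁻¹ + (Z⁻¹ * C) * (fpi Cᴴ R k + Z - R)⁻¹ * (Z⁻¹ * C)ᴴ := by
  have hw := fpi_dual_posDef hZ hs k
  have hD := fpi_dual_sub_posDef hZ hs k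
  have e : fpi Cᴴ R k + Z - R = fpi Cᴴ R k - Cᴴ * Z⁻¹ * C := by
    linear_combination (norm := noncomm_ring) -hs
  have e' : fpi Cᴴ R (k + 1) + Z - R = Z - C * (fpi Cᴴ R k)⁻¹ * Cᴴ := by
    rw [fpi, Matrix.conjTranspose_conjTranspose]; abel
  have := woodbury hZ.isUnit hw.isUnit (e ▸ hD.isUnit)
  rw [e', this, e, Matrix.conjTranspose_mul, hZ.inv.isHermitian.eq]
  noncomm_ring

end Coupled

section Spectrum

variable {𝕜 : Type*} [RCLike 𝕜] {n : Type*} [Fintype n] [DecidableEq n]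

theorem mem_spectrum_iff_exists {K : Type*} [Field K] {M : Matrix n n K} {μ : K} :
    μ ∈ spectrum K M ↔ ∃ x ≠ 0, M *ᵥ x = μ • x := by
  rw [spectrum.mem_iff, Matrix.isUnit_iff_isUnit_det, isUnit_iff_ne_zero, not_not,
    ← Matrix.exists_mulVec_eq_zero_iff]
  simp only [Matrix.sub_mulVec, Algebra.algebraMap_eq_smul_one, Matrix.smul_mulVec,
    Matrix.one_mulVec, sub_eq_zero, eq_comm]

theorem star_mem_spectrum_conjTranspose {M : Matrix n n ℂ} {μ : ℂ} :
    star μ ∈ spectrum ℂ Mᴴ ↔ μ ∈ spectrum ℂ M := by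
  rw [← Matrix.star_eq_conjTranspose, spectrum.map_star, Set.mem_star, star_star]

theorem spec_conjTranspose {M : Matrix n n 𝕜} {μ : ℂ} : star μ ∈ spec Mᴴ ↔ μ ∈ spec M := by
  rw [spec, spec, toComplex_conjTranspose, star_mem_spectrum_conjTranspose]

theorem specRadius_le_one_iff {M : Matrix n n 𝕜} :
    specRadius M ≤ 1 ↔ ∀ μ ∈ spec M, ‖μ‖ ≤ 1 := by
  simp only [specRadius, spectralRadius, iSup_le_iff, spec]
  refine forall₂_congr fun μ _ => ?_
  rw [← ENNReal.coe_one, ENNReal.coe_le_coe, ← NNReal.coe_le_coe]; rfl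

theorem specRadius_lt_one_iff {M : Matrix n n 𝕜} :
    specRadius M < 1 ↔ ∀ μ ∈ spec M, ‖μ‖ < 1 := by
  constructor
  · intro h μ hμ
    have : (‖μ‖₊ : ℝ≥0∞) ≤ specRadius M := le_iSup₂ (f := fun (k : ℂ) (_ : k ∈ spec M) =>
      (‖k‖₊ : ℝ≥0∞)) μ hμ
    have := this.trans_lt h
    rw [← ENNReal.coe_one, ENNReal.coe_lt_coe, ← NNReal.coe_lt_coe] at this
    exact this
  · intro h
    have hfin : (spec M).Finite := Matrix.finite_spectrum (toComplex M)
    have : specRadius M = hfin.toFinset.sup fun k => (‖k‖₊ : ℝ≥0∞) := by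
      rw [Finset.sup_eq_iSup]
      simp only [specRadius, spectralRadius, Set.Finite.mem_toFinset]
      rfl
    rw [this, Finset.sup_lt_iff (by simp)]
    intro μ hμ
    have := h μ (by simpa using hμ)
    rw [← ENNReal.coe_one, ENNReal.coe_lt_coe, ← NNReal.coe_lt_coe]
    exact this

theorem specRadius_eq_of_spec_eq {M N : Matrix n n 𝕜} (h : spec M = spec N) :
    specRadius M = specRadius N := by
  simp only [spec] at h
  simp only [specRadius, spectralRadius, h]

omit [DecidableEq n] in
theorem dotProduct_conj_mul_mulVec (V M : Matrix n n 𝕜) (x : n → 𝕜) :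
    star x ⬝ᵥ ((Mᴴ * V * M) *ᵥ x) = star (M *ᵥ x) ⬝ᵥ (V *ᵥ (M *ᵥ x)) := by
  rw [mul_assoc, ← Matrix.mulVec_mulVec, Matrix.dotProduct_mulVec, ← Matrix.star_mulVec,
    Matrix.mulVec_mulVec]

/-- A strict Stein inequality implies that the spectral radius is less than one. -/
theorem specRadius_lt_one_of_stein {V T : Matrix n n 𝕜} (hV : V.PosDef)
    (h : (V - Tᴴ * V * T).PosDef) : specRadius T < 1 := by
  rw [specRadius_lt_one_iff]
  intro μ hμ
  obtain ⟨x, hx, hTx⟩ := mem_spectrum_iff_exists.1 hμ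
  have h1 := (posDef_toComplex.2 hV).dotProduct_mulVec_pos hx
  have h2 := (posDef_toComplex.2 h).dotProduct_mulVec_pos hx
  rw [toComplex_sub, toComplex_mul, toComplex_mul, toComplex_conjTranspose, Matrix.sub_mulVec,
    dotProduct_sub, dotProduct_conj_mul_mulVec, hTx, Matrix.mulVec_smul, star_smul,
    smul_dotProduct, dotProduct_smul, smul_eq_mul, smul_eq_mul, ← mul_assoc, Complex.star_def,
    Complex.conj_mul'] at h2
  set q := star x ⬝ᵥ (toComplex V *ᵥ x)
  have h1' := (Complex.pos_iff.1 h1).1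
  have h2' := (Complex.pos_iff.1 h2).1
  rw [← Complex.ofReal_pow, Complex.sub_re, Complex.re_ofReal_mul] at h2'
  have : ‖μ‖ ^ 2 < 1 := by nlinarith
  nlinarith [norm_nonneg μ]

/-- The Cauchy–Schwarz inequality for a positive definite matrix and its inverse. -/
theorem norm_dotProduct_sq_le {D : Matrix n n ℂ} (hD : D.PosDef) (y v : n → ℂ) :
    ‖star y ⬝ᵥ v‖ ^ 2 ≤ (star y ⬝ᵥ (D *ᵥ y)).re * (star v ⬝ᵥ (D⁻¹ *ᵥ v)).re := by
  by_cases hv : v = 0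
  · simp [hv]
  have hg := hD.inv.dotProduct_mulVec_pos hv
  set g := star v ⬝ᵥ (D⁻¹ *ᵥ v)
  set β := star y ⬝ᵥ v with hβ
  have hβ' : star v ⬝ᵥ y = star β := by rw [hβ, Matrix.star_dotProduct]
  have hg' := Complex.pos_iff.1 hg
  have hgr : g = (g.re : ℂ) := by
    apply Complex.ext
    · simp
    · simp [← hg'.2]
  set c : ℂ := star β / g with hc
  have hq := hD.posSemidef.dotProduct_mulVec_nonneg (y - c • (D⁻¹ *ᵥ v))
  have e1 : D *ᵥ (D⁻¹ *ᵥ v) = v := by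
    rw [Matrix.mulVec_mulVec, mul_inv_self hD.isUnit, Matrix.one_mulVec]
  have e2 : star (D⁻¹ *ᵥ v) ⬝ᵥ (D *ᵥ y) = star v ⬝ᵥ y := by
    rw [Matrix.star_mulVec, hD.inv.isHermitian.eq, ← Matrix.dotProduct_mulVec,
      Matrix.mulVec_mulVec, inv_mul_self hD.isUnit, Matrix.one_mulVec]
  have e3 : star (D⁻¹ *ᵥ v) ⬝ᵥ v = g := by
    rw [Matrix.star_mulVec, hD.inv.isHermitian.eq, ← Matrix.dotProduct_mulVec]
  simp only [star_sub, star_smul, Matrix.mulVec_sub, Matrix.mulVec_smul, sub_dotProduct,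
    dotProduct_sub, smul_dotProduct, dotProduct_smul, smul_eq_mul, e1, e2, e3, hβ'] at hq
  rw [← hβ] at hq
  have hg0 : g ≠ 0 := hg.ne'
  have hcg : c * g = star β := div_mul_cancel₀ _ hg0
  have hcb : c * β = ((‖β‖ ^ 2 / g.re : ℝ) : ℂ) := by
    rw [hc, div_mul_eq_mul_div, Complex.star_def, Complex.conj_mul']
    nth_rw 1 [hgr]
    push_cast
    rfl
  have hq2 : 0 ≤ (star y ⬝ᵥ (D *ᵥ y)) - c * β := by
    convert hq using 1
    linear_combination -star c * hcg
  rw [hcb] at hq2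
  have := (Complex.nonneg_iff.1 hq2).1
  rw [Complex.sub_re, Complex.ofReal_re, sub_nonneg, div_le_iff₀ hg'.1] at this
  exact this

theorem conjTranspose_pow_mulVec {T : Matrix n n ℂ} {v : n → ℂ} {c : ℂ} (h : Tᴴ *ᵥ v = c • v)
    (k : ℕ) : (T ^ k)ᴴ *ᵥ v = c ^ k • v := by
  induction k with
  | zero => simp
  | succ k ih =>
    rw [pow_succ', Matrix.conjTranspose_mul, ← Matrix.mulVec_mulVec, h, Matrix.mulVec_smul, ih,
      smul_smul, pow_succ']

theorem norm_pow_mul_le_of_conjTranspose_mulVec {T D : Matrix n n ℂ} {v : n → ℂ} {μ : ℂ}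
    (hD : D.PosDef) (h : Tᴴ *ᵥ v = star μ • v) (k : ℕ) :
    (‖μ‖ ^ 2) ^ k * ‖star v ⬝ᵥ v‖ ^ 2 ≤
      (star v ⬝ᵥ (((T ^ k)ᴴ * D * T ^ k) *ᵥ v)).re * (star v ⬝ᵥ (D⁻¹ *ᵥ v)).re := by
  have h1 := norm_dotProduct_sq_le hD (T ^ k *ᵥ v) v
  have h2 : ‖star (T ^ k *ᵥ v) ⬝ᵥ v‖ ^ 2 = (‖μ‖ ^ 2) ^ k * ‖star v ⬝ᵥ v‖ ^ 2 := by
    rw [Matrix.star_mulVec, ← Matrix.dotProduct_mulVec, conjTranspose_pow_mulVec h, dotProduct_smul,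
      smul_eq_mul, norm_mul, norm_pow, norm_star, mul_pow, ← pow_mul, ← pow_mul, mul_comm k]
  rwa [h2, ← dotProduct_conj_mul_mulVec] at h1

omit [DecidableEq n] in
theorem dotProduct_star_self_ne_zero {v : n → ℂ} (hv : v ≠ 0) : star v ⬝ᵥ v ≠ 0 := by
  simpa using hv

omit [DecidableEq n] in
theorem tendsto_re_dotProduct_mulVec (v : n → ℂ) {E : ℕ → Matrix n n ℂ}
    (hE : Filter.Tendsto E Filter.atTop (nhds 0)) :
    Filter.Tendsto (fun k => (star v ⬝ᵥ (E k *ᵥ v)).re) Filter.atTop (nhds 0) := by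
  have hc : Continuous fun M : Matrix n n ℂ => (star v ⬝ᵥ (M *ᵥ v)).re :=
    Complex.continuous_re.comp (Continuous.dotProduct continuous_const
      (Continuous.matrix_mulVec continuous_id continuous_const))
  have h := (hc.tendsto 0).comp hE
  rw [Matrix.zero_mulVec, dotProduct_zero, Complex.zero_re] at h
  exact h

theorem mul_sub_one_le_of_growth {m ζ s g e : ℝ} {k : ℕ} (hm1 : 1 < m) (hζ0 : 0 < ζ)
    (hs0 : 0 < s) (hg : 0 < g) (hgk : g * (m - 1) = ζ * (m ^ (k + 1) - 1))
    (hcs : m ^ (k + 1) * s ≤ e * g) : s * (m - 1) ≤ e * ζ := by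
  have hmk : 0 < m ^ (k + 1) := pow_pos (by linarith) _
  have hepos : 0 ≤ e := by
    by_contra! hneg
    exact absurd (hcs.trans (mul_neg_of_neg_of_pos hneg hg).le) (not_le.2 (mul_pos hmk hs0))
  have h1 := mul_le_mul_of_nonneg_right hcs (sub_pos.2 hm1).le
  rw [mul_assoc e, hgk] at h1
  have h2 : 0 ≤ e * ζ := mul_nonneg hepos hζ0.le
  exact le_of_mul_le_mul_left (by linarith) hmk

/-- If the Gramians `D k⁻¹` of `T` grow so fast that `(T ^ k)ᴴ * D k * T ^ k` tends to zero, then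
the spectral radius of `T` is at most one. -/
theorem norm_le_one_of_gramian {Z T : Matrix n n ℂ} {D : ℕ → Matrix n n ℂ} (hZ : Z.PosDef)
    (hD : ∀ k, (D k).PosDef) (h0 : D 0 = Z)
    (hrec : ∀ k, (D (k + 1))⁻¹ = Z⁻¹ + T * (D k)⁻¹ * Tᴴ)
    (hlim : Filter.Tendsto (fun k => (T ^ (k + 1))ᴴ * D k * T ^ (k + 1)) Filter.atTop (nhds 0))
    {μ : ℂ} (hμ : μ ∈ spectrum ℂ T) : ‖μ‖ ≤ 1 := by
  by_contra! hgt
  obtain ⟨v, hv, hTv⟩ := mem_spectrum_iff_exists.1 (star_mem_spectrum_conjTranspose.2 hμ)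
  set m : ℝ := ‖μ‖ ^ 2 with hm
  have hm1 : 1 < m := by rw [hm]; nlinarith
  set ζ := (star v ⬝ᵥ (Z⁻¹ *ᵥ v)).re with hζ
  have hζ0 : 0 < ζ := (Complex.pos_iff.1 (hZ.inv.dotProduct_mulVec_pos hv)).1
  set g : ℕ → ℝ := fun k => (star v ⬝ᵥ ((D k)⁻¹ *ᵥ v)).re with hg
  have hgrec : ∀ k, g (k + 1) = ζ + m * g k := by
    intro k
    have := dotProduct_conj_mul_mulVec (D k)⁻¹ Tᴴ v
    rw [Matrix.conjTranspose_conjTranspose, hTv, Matrix.mulVec_smul, star_smul,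
      smul_dotProduct, dotProduct_smul, smul_eq_mul, smul_eq_mul, ← mul_assoc, star_star,
      Complex.star_def, Complex.mul_conj', ← Complex.ofReal_pow] at this
    simp only [hg, hrec, Matrix.add_mulVec, dotProduct_add, Complex.add_re, this,
      Complex.re_ofReal_mul, hζ, hm]
  have hgk : ∀ k, g k * (m - 1) = ζ * (m ^ (k + 1) - 1) := by
    intro k
    induction k with
    | zero => simp [hg, h0, hζ]
    | succ k ih => rw [hgrec, add_mul, mul_assoc, ih]; ring
  set s : ℝ := ‖star v ⬝ᵥ v‖ ^ 2 with hs
  have hs0 : 0 < s := by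
    exact pow_pos (norm_pos_iff.2 (dotProduct_star_self_ne_zero hv)) 2
  set e : ℕ → ℝ := fun k => (star v ⬝ᵥ (((T ^ (k + 1))ᴴ * D k * T ^ (k + 1)) *ᵥ v)).re with he
  have hcs : ∀ k, m ^ (k + 1) * s ≤ e k * g k := fun k =>
    norm_pow_mul_le_of_conjTranspose_mulVec (hD k) hTv (k + 1)
  have hgpos : ∀ k, 0 < g k := fun k =>
    (Complex.pos_iff.1 ((hD k).inv.dotProduct_mulVec_pos hv)).1
  have hek : ∀ k, s * (m - 1) ≤ e k * ζ := fun k =>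
    mul_sub_one_le_of_growth hm1 hζ0 hs0 (hgpos k) (hgk k) (hcs k)
  have hetend : Filter.Tendsto e Filter.atTop (nhds 0) := tendsto_re_dotProduct_mulVec v hlim
  have h1 := ge_of_tendsto' (hetend.mul_const ζ) hek
  rw [zero_mul] at h1
  exact absurd h1 (not_le.2 (mul_pos hs0 (sub_pos.2 hm1)))

end Spectrum

section Rates

variable {𝕜 : Type*} [RCLike 𝕜] {n : Type*} [Fintype n] [DecidableEq n]

/-- The sum of the absolute values of the entries of a matrix. -/
def entryNorm (M : Matrix n n 𝕜) : ℝ := ∑ i, ∑ j, ‖M i j‖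

omit [DecidableEq n] in
theorem entryNorm_nonneg (M : Matrix n n 𝕜) : 0 ≤ entryNorm M :=
  Finset.sum_nonneg fun _ _ => Finset.sum_nonneg fun _ _ => norm_nonneg _

omit [DecidableEq n] in
theorem norm_apply_le_entryNorm (M : Matrix n n 𝕜) (i j : n) : ‖M i j‖ ≤ entryNorm M :=
  (Finset.single_le_sum (f := fun j => ‖M i j‖) (fun _ _ => norm_nonneg _)
    (Finset.mem_univ j)).trans
    (Finset.single_le_sum (f := fun i => ∑ j, ‖M i j‖)
      (fun _ _ => Finset.sum_nonneg fun _ _ => norm_nonneg _) (Finset.mem_univ i))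

omit [DecidableEq n] in
theorem entryNorm_mul_le (M N : Matrix n n 𝕜) :
    entryNorm (M * N) ≤ entryNorm M * entryNorm N := by
  calc entryNorm (M * N) ≤ ∑ i, ∑ j, ∑ k, ‖M i k‖ * ‖N k j‖ := by
        refine Finset.sum_le_sum fun i _ => Finset.sum_le_sum fun j _ => ?_
        rw [Matrix.mul_apply]
        refine (norm_sum_le _ _).trans (Finset.sum_le_sum fun k _ => norm_mul_le _ _)
    _ = ∑ i, ∑ k, ‖M i k‖ * ∑ j, ‖N k j‖ := by
        refine Finset.sum_congr rfl fun i _ => ?_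
        rw [Finset.sum_comm]
        simp only [Finset.mul_sum]
    _ ≤ ∑ i, ∑ k, ‖M i k‖ * entryNorm N := by
        refine Finset.sum_le_sum fun i _ => Finset.sum_le_sum fun k _ => ?_
        refine mul_le_mul_of_nonneg_left ?_ (norm_nonneg _)
        exact Finset.single_le_sum (f := fun k => ∑ j, ‖N k j‖)
          (fun _ _ => Finset.sum_nonneg fun _ _ => norm_nonneg _) (Finset.mem_univ k)
    _ = entryNorm M * entryNorm N := by simp only [entryNorm, Finset.sum_mul]

omit [DecidableEq n] in
theorem entryNorm_conjTranspose (M : Matrix n n 𝕜) : entryNorm Mᴴ = entryNorm M := by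
  simp only [entryNorm, Matrix.conjTranspose_apply, norm_star]
  exact Finset.sum_comm

omit [DecidableEq n] in
theorem continuous_entryNorm : Continuous (entryNorm : Matrix n n 𝕜 → ℝ) :=
  continuous_finsetSum _ fun i _ => continuous_finsetSum _ fun j _ =>
    (Continuous.matrix_elem continuous_id i j).norm

theorem seminorm_le_entryNorm (N : Seminorm 𝕜 (Matrix n n 𝕜)) :
    ∃ c, 0 < c ∧ ∀ M, N M ≤ c * entryNorm M := by
  refine ⟨1 + ∑ i, ∑ j, N (Matrix.single i j 1), ?_, fun M => ?_⟩
  · have : 0 ≤ ∑ i, ∑ j, N (Matrix.single i j (1 : 𝕜)) :=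
      Finset.sum_nonneg fun _ _ => Finset.sum_nonneg fun _ _ => apply_nonneg N _
    linarith
  have hbd : ∀ i j, N (Matrix.single i j (1 : 𝕜)) ≤ 1 + ∑ i, ∑ j, N (Matrix.single i j (1 : 𝕜)) := by
    intro i j
    have h1 := Finset.single_le_sum (f := fun j => N (Matrix.single i j (1 : 𝕜)))
      (fun _ _ => apply_nonneg N _) (Finset.mem_univ j)
    have h2 := Finset.single_le_sum (f := fun i => ∑ j, N (Matrix.single i j (1 : 𝕜)))
      (fun _ _ => Finset.sum_nonneg fun _ _ => apply_nonneg N _) (Finset.mem_univ i)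
    exact (h1.trans h2).trans (by linarith)
  have hsum : ∀ (s : Finset n) (g : n → Matrix n n 𝕜), N (∑ i ∈ s, g i) ≤ ∑ i ∈ s, N (g i) :=
    fun s g => Finset.le_sum_of_subadditive N (map_zero N).le (map_add_le_add N) s g
  conv_lhs => rw [Matrix.matrix_eq_sum_single M]
  rw [entryNorm, Finset.mul_sum]
  refine (hsum _ _).trans (Finset.sum_le_sum fun i _ => ?_)
  rw [Finset.mul_sum]
  refine (hsum _ _).trans (Finset.sum_le_sum fun j _ => ?_)
  have : Matrix.single i j (M i j) = M i j • Matrix.single i j (1 : 𝕜) := by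
    rw [Matrix.smul_single, smul_eq_mul, mul_one]
  rw [this, map_smul_eq_mul, mul_comm]
  exact mul_le_mul_of_nonneg_right (hbd i j) (norm_nonneg _)

section Gelfand

attribute [local instance] Matrix.linftyOpNormedRing Matrix.linftyOpNormedAlgebra

theorem entryNorm_le_norm (M : Matrix n n 𝕜) : entryNorm M ≤ Fintype.card n * ‖toComplex M‖ := by
  have : ∀ i, ∑ j, ‖M i j‖ ≤ ‖toComplex M‖ := by
    intro i
    have h1 : ∑ j, ‖M i j‖₊ ≤ ‖toComplex M‖₊ := by
      rw [Matrix.linfty_opNNNorm_def]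
      refine le_trans (le_of_eq ?_)
        (Finset.le_sup (f := fun i => ∑ j, ‖toComplex M i j‖₊) (Finset.mem_univ i))
      refine Finset.sum_congr rfl fun j _ => ?_
      exact NNReal.eq (norm_embC (M i j)).symm
    simpa using NNReal.coe_le_coe.2 h1
  refine (Finset.sum_le_sum fun i _ => this i).trans ?_
  simp

theorem exists_norm_pow_le (M : Matrix n n ℂ) {r : ℝ} (hr0 : 0 < r)
    (hr : spectralRadius ℂ M < ENNReal.ofReal r) : ∃ K, 0 < K ∧ ∀ k, ‖M ^ k‖ ≤ K * r ^ k := by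
  have h1 := (spectrum.limsup_pow_nnnorm_pow_one_div_le_spectralRadius M).trans_lt hr
  have h2 := Filter.eventually_lt_of_limsup_lt h1
  obtain ⟨m, hm⟩ := Filter.eventually_atTop.1 h2
  have h3 : ∀ k, m + 1 ≤ k → ‖M ^ k‖ ≤ r ^ k := by
    intro k hk
    have hk0 : (k : ℝ) ≠ 0 := Nat.cast_ne_zero.2 (by omega)
    have := (hm k (by omega)).le
    have h4 := ENNReal.rpow_le_rpow this (Nat.cast_nonneg (α := ℝ) k)
    rw [← ENNReal.rpow_mul, one_div_mul_cancel hk0, ENNReal.rpow_one, ENNReal.rpow_natCast,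
      ← ENNReal.ofReal_pow hr0.le, ENNReal.ofReal, ENNReal.coe_le_coe,
      Real.le_toNNReal_iff_coe_le (by positivity)] at h4
    exact h4
  refine ⟨1 + ∑ k ∈ Finset.range (m + 1), ‖M ^ k‖ / r ^ k, ?_, fun k => ?_⟩
  · have : 0 ≤ ∑ k ∈ Finset.range (m + 1), ‖M ^ k‖ / r ^ k :=
      Finset.sum_nonneg fun _ _ => by positivity
    linarith
  have hrk : 0 < r ^ k := by positivity
  rcases lt_or_ge k (m + 1) with hk | hk
  · have := Finset.single_le_sum (f := fun k => ‖M ^ k‖ / r ^ k)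
      (fun _ _ => by positivity) (Finset.mem_range.2 hk)
    rw [← div_le_iff₀ hrk]
    exact this.trans (by linarith)
  · have : 0 ≤ ∑ k ∈ Finset.range (m + 1), ‖M ^ k‖ / r ^ k :=
      Finset.sum_nonneg fun _ _ => by positivity
    nlinarith [h3 k hk]

theorem exists_entryNorm_pow_le (M : Matrix n n 𝕜) {r : ℝ} (hr0 : 0 < r)
    (hr : specRadius M < ENNReal.ofReal r) : ∃ K, 0 < K ∧ ∀ k, entryNorm (M ^ k) ≤ K * r ^ k := by
  obtain ⟨K, hK, h⟩ := exists_norm_pow_le (toComplex M) hr0 hr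
  refine ⟨(Fintype.card n + 1) * K, by positivity, fun k => ?_⟩
  refine (entryNorm_le_norm _).trans ?_
  rw [toComplex_pow, mul_assoc]
  have := h k
  have h0 := norm_nonneg (toComplex M ^ k)
  gcongr
  linarith

end Gelfand

theorem exists_real_btwn_specRadius {M : Matrix n n 𝕜} {y : ℝ≥0∞} (h : specRadius M < y) :
    ∃ r : ℝ, 0 < r ∧ specRadius M < ENNReal.ofReal r ∧ ENNReal.ofReal r < y := by
  obtain ⟨r, -, h1, h2⟩ := ENNReal.lt_iff_exists_real_btwn.1 h
  exact ⟨r, ENNReal.ofReal_pos.1 (zero_le.trans_lt h1), h1, h2⟩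

theorem tendsto_pow_of_specRadius_lt_one {M : Matrix n n 𝕜} (h : specRadius M < 1) :
    Filter.Tendsto (fun k => M ^ k) Filter.atTop (nhds 0) := by
  obtain ⟨r, hr0, hr, hr1⟩ := exists_real_btwn_specRadius h
  rw [ENNReal.ofReal_lt_one] at hr1
  obtain ⟨K, -, hK⟩ := exists_entryNorm_pow_le M hr0 hr
  have ht : Filter.Tendsto (fun k => K * r ^ k) Filter.atTop (nhds 0) := by
    simpa using (tendsto_pow_atTop_nhds_zero_of_lt_one hr0.le hr1).const_mul K
  refine tendsto_pi_nhds.2 fun i => tendsto_pi_nhds.2 fun j => ?_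
  exact squeeze_zero_norm (fun k => (norm_apply_le_entryNorm _ i j).trans (hK k)) ht

omit [Fintype n] [DecidableEq n] in
theorem rootRate_le_of_le {N : Seminorm 𝕜 (Matrix n n 𝕜)} {u : ℕ → Matrix n n 𝕜} {c r : ℝ}
    (hc : 0 < c) (hr : 0 ≤ r) (hu : ∀ k, N (u k) ≤ c * r ^ (k + 1)) :
    rootRate N u ≤ ENNReal.ofReal r := by
  have h0 : Filter.Tendsto (fun k : ℕ => c ^ (1 / ((k : ℝ) + 1)) * r) Filter.atTop (nhds r) := by
    have := ((Real.continuousAt_const_rpow hc.ne').tendsto.comp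
      (tendsto_one_div_add_atTop_nhds_zero_nat (𝕜 := ℝ))).mul_const r
    simpa using this
  have h1 := (ENNReal.continuous_ofReal.tendsto r).comp h0
  rw [rootRate, ← h1.limsup_eq]
  refine Filter.limsup_le_limsup (Filter.Eventually.of_forall fun k => ?_)
  refine ENNReal.ofReal_le_ofReal ?_
  have hk : (0 : ℝ) ≤ 1 / ((k : ℝ) + 1) := by positivity
  refine (Real.rpow_le_rpow (apply_nonneg N _) (hu k) hk).trans_eq ?_
  rw [Real.mul_rpow hc.le (by positivity), ← Real.rpow_natCast r, ← Real.rpow_mul hr]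
  have : ((k + 1 : ℕ) : ℝ) * (1 / ((k : ℝ) + 1)) = 1 := by
    push_cast
    field_simp
  rw [this, Real.rpow_one]

theorem le_mul_pow_of_le {N : Seminorm 𝕜 (Matrix n n 𝕜)} {u : ℕ → Matrix n n 𝕜}
    {T : Matrix n n 𝕜} {c K r : ℝ} {p : ℕ} (hc : 0 < c)
    (hK : ∀ k, entryNorm (T ^ k) ≤ K * r ^ k)
    (hu : ∀ k, N (u k) ≤ c * entryNorm (T ^ (k + 1)) ^ p) (k : ℕ) :
    N (u k) ≤ c * K ^ p * (r ^ p) ^ (k + 1) := by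
  refine (hu k).trans ?_
  have h1 := pow_le_pow_left₀ (entryNorm_nonneg _) (hK (k + 1)) p
  calc c * entryNorm (T ^ (k + 1)) ^ p ≤ c * (K * r ^ (k + 1)) ^ p :=
        mul_le_mul_of_nonneg_left h1 hc.le
    _ = c * K ^ p * (r ^ p) ^ (k + 1) := by ring

theorem rootRate_le {N : Seminorm 𝕜 (Matrix n n 𝕜)} {u : ℕ → Matrix n n 𝕜} {T : Matrix n n 𝕜}
    {c : ℝ} {p : ℕ} (hp : p ≠ 0) (hc : 0 < c)
    (hu : ∀ k, N (u k) ≤ c * entryNorm (T ^ (k + 1)) ^ p) :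
    rootRate N u ≤ specRadius T ^ p := by
  have key : ∀ y, specRadius T < y → rootRate N u ≤ y ^ p := by
    intro y hy
    obtain ⟨r, hr0, hr, hry⟩ := exists_real_btwn_specRadius hy
    obtain ⟨K, hK0, hK⟩ := exists_entryNorm_pow_le T hr0 hr
    have := rootRate_le_of_le (by positivity) (by positivity) (le_mul_pow_of_le hc hK hu)
    refine this.trans ?_
    rw [ENNReal.ofReal_pow hr0.le]
    exact pow_le_pow_left₀ zero_le hry.le p
  by_cases htop : specRadius T = ⊤
  · rw [htop, ENNReal.top_pow hp]
    exact le_top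
  · have : (nhdsWithin (specRadius T) (Set.Ioi (specRadius T))).NeBot :=
      nhdsGT_neBot_of_exists_gt ⟨⊤, lt_top_iff_ne_top.2 htop⟩
    refine ge_of_tendsto (x := nhdsWithin (specRadius T) (Set.Ioi (specRadius T)))
      (((ENNReal.continuous_pow p).tendsto (specRadius T)).mono_left nhdsWithin_le_nhds) ?_
    filter_upwards [self_mem_nhdsWithin] with y hy using key y hy

theorem rLinear_of_le {N : Seminorm 𝕜 (Matrix n n 𝕜)} {u : ℕ → Matrix n n 𝕜} {L T : Matrix n n 𝕜}
    {c : ℝ} {p : ℕ} (hp : p ≠ 0) (hc : 0 < c) (hT : specRadius T < 1)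
    (hu : ∀ k, N (u k - L) ≤ c * entryNorm (T ^ (k + 1)) ^ p) : RLinear N u L := by
  obtain ⟨r, hr0, hr, hr1⟩ := exists_real_btwn_specRadius hT
  rw [ENNReal.ofReal_lt_one] at hr1
  obtain ⟨K, hK0, hK⟩ := exists_entryNorm_pow_le T hr0 hr
  have hrp1 : r ^ p < 1 := pow_lt_one₀ hr0.le hr1 hp
  refine ⟨c * K ^ p, r ^ p, by positivity, by positivity, hrp1, fun k _ => ?_⟩
  refine (le_mul_pow_of_le (u := fun k => u k - L) hc hK hu k).trans_lt ?_
  have h0 : 0 < c * K ^ p * (r ^ p) ^ k := by positivity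
  rw [pow_succ, ← mul_assoc]
  exact mul_lt_of_lt_one_right h0 hrp1

omit [DecidableEq n] in
/-- A convergent sequence of matrices is bounded. -/
theorem exists_entryNorm_le_of_tendsto {D : ℕ → Matrix n n 𝕜} {L : Matrix n n 𝕜}
    (h : Filter.Tendsto D Filter.atTop (nhds L)) : ∃ c, 0 < c ∧ ∀ k, entryNorm (D k) ≤ c := by
  have := ((continuous_entryNorm.tendsto L).comp h).bddAbove_range
  obtain ⟨c, hc⟩ := this
  exact ⟨max c 1, by positivity, fun k => (hc ⟨k, rfl⟩).trans (le_max_left _ _)⟩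

end Rates

section Reduced

variable {𝕜 : Type*} [RCLike 𝕜] {n : Type*} [Fintype n] [DecidableEq n]

theorem not_isUnit_mul {M N : Matrix n n 𝕜} (h : ¬ IsUnit (M * N)) : ¬ IsUnit M ∨ ¬ IsUnit N := by
  by_contra! h'
  exact h (h'.1.mul h'.2)

theorem spec_subset_of_dual_complex {C R Z W : Matrix n n ℂ} (hZ : Z.PosDef) (hW : W.PosDef)
    (hZs : R - Cᴴ * Z⁻¹ * C = Z) (hWs : R - C * W⁻¹ * Cᴴ = W)
    (hT : ∀ μ ∈ spectrum ℂ (Z⁻¹ * C), ‖μ‖ ≤ 1) (hS : ∀ μ ∈ spectrum ℂ (C * W⁻¹), ‖μ‖ ≤ 1) :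
    spectrum ℂ (Z⁻¹ * C) ⊆ spectrum ℂ (C * W⁻¹) := by
  intro μ hμ
  have eZ := mul_inv_self hZ.isUnit
  have eZ' := inv_mul_self hZ.isUnit
  have eW := mul_inv_self hW.isUnit
  have eW' := inv_mul_self hW.isUnit
  have hmemS : ∀ ν : ℂ, ¬ IsUnit (ν • W - C) → ν ∈ spectrum ℂ (C * W⁻¹) := by
    intro ν hν
    rw [spectrum.mem_iff, Algebra.algebraMap_eq_smul_one]
    intro hu
    apply hν
    have : ν • W - C = (ν • (1 : Matrix n n ℂ) - C * W⁻¹) * W := by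
      rw [sub_mul, mul_assoc C, eW', Matrix.smul_mul, one_mul, mul_one]
    rw [this]
    exact hu.mul hW.isUnit
  have h1 : ¬ IsUnit (μ • Z - C) := by
    rw [spectrum.mem_iff, Algebra.algebraMap_eq_smul_one] at hμ
    intro hu
    apply hμ
    have : μ • (1 : Matrix n n ℂ) - Z⁻¹ * C = Z⁻¹ * (μ • Z - C) := by
      rw [mul_sub, Matrix.mul_smul, eZ']
    rw [this]
    exact (isUnit_inv hZ.isUnit).mul hu
  by_cases hμ0 : μ = 0
  · subst hμ0
    apply hmemS
    simpa using h1
  have hfac : (Z - μ • Cᴴ) * Z⁻¹ * (μ • Z - C) = (μ • W - C) * W⁻¹ * (W - μ • Cᴴ) := by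
    have e1 : (Z - μ • Cᴴ) * Z⁻¹ * (μ • Z - C) =
        μ • (Z + Cᴴ * Z⁻¹ * C) - C - (μ * μ) • Cᴴ := by
      simp only [sub_mul, mul_sub, Matrix.smul_mul, Matrix.mul_smul, eZ, one_mul,
        smul_add, smul_smul, mul_assoc, eZ', mul_one]
      abel
    have e2 : (μ • W - C) * W⁻¹ * (W - μ • Cᴴ) =
        μ • (W + C * W⁻¹ * Cᴴ) - C - (μ * μ) • Cᴴ := by
      simp only [sub_mul, mul_sub, Matrix.smul_mul, Matrix.mul_smul, eW, one_mul,
        smul_add, smul_smul, mul_assoc, eW', mul_one]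
      abel
    rw [e1, e2, ← sub_eq_iff_eq_add.1 hZs, ← sub_eq_iff_eq_add.1 hWs]
  have h2 : ¬ IsUnit ((μ • W - C) * W⁻¹ * (W - μ • Cᴴ)) := by
    rw [← hfac]
    intro hu
    apply h1
    rw [Matrix.isUnit_iff_isUnit_det, Matrix.det_mul] at hu
    rw [Matrix.isUnit_iff_isUnit_det]
    exact isUnit_of_mul_isUnit_right hu
  rcases not_isUnit_mul h2 with h3 | h3
  · rcases not_isUnit_mul h3 with h4 | h4
    · exact hmemS μ h4
    · exact absurd (isUnit_inv hW.isUnit) h4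
  · have h4 : (star μ)⁻¹ ∈ spectrum ℂ (C * W⁻¹) := by
      apply hmemS
      intro hu
      apply h3
      have h0 : star μ ≠ 0 := star_ne_zero.2 hμ0
      have h5 : IsUnit (star μ • ((star μ)⁻¹ • W - C)) := hu.smul (Units.mk0 _ h0)
      rw [smul_sub, smul_smul, mul_inv_cancel₀ h0, one_smul] at h5
      rw [← Matrix.isUnit_conjTranspose]
      simpa [hW.isHermitian.eq] using h5
    have h5 := hS _ h4
    rw [norm_inv, norm_star] at h5
    have h6 := hT _ hμ
    have h7 : 0 < ‖μ‖ := norm_pos_iff.2 hμ0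
    have h8 : ‖μ‖ = 1 := le_antisymm h6 (by rwa [inv_le_one₀ h7] at h5)
    have h9 : (star μ)⁻¹ = μ := by
      apply inv_eq_of_mul_eq_one_right
      rw [Complex.star_def, Complex.conj_mul', h8]
      simp
    rwa [h9] at h4

theorem spec_subset_of_dual {C R Z W : Matrix n n 𝕜} (hZ : Z.PosDef) (hW : W.PosDef)
    (hZs : R - Cᴴ * Z⁻¹ * C = Z) (hWs : R - C * W⁻¹ * Cᴴ = W)
    (hT : specRadius (Z⁻¹ * C) ≤ 1) (hS : specRadius (C * W⁻¹) ≤ 1) :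
    spec (Z⁻¹ * C) ⊆ spec (C * W⁻¹) := by
  rw [specRadius_le_one_iff] at hT hS
  simp only [spec, toComplex_mul, toComplex_inv hZ.isUnit, toComplex_inv hW.isUnit] at hT hS ⊢
  refine spec_subset_of_dual_complex (R := toComplex R) (posDef_toComplex.2 hZ)
    (posDef_toComplex.2 hW) ?_ ?_ hT hS
  · rw [← toComplex_inv hZ.isUnit, ← toComplex_conjTranspose, ← toComplex_mul, ← toComplex_mul,
      ← toComplex_sub, hZs]
  · rw [← toComplex_inv hW.isUnit, ← toComplex_conjTranspose, ← toComplex_mul, ← toComplex_mul,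
      ← toComplex_sub, hWs]

/-- `Z` is the limit of the fixed point iteration and a positive definite solution of the reduced
equation `Z + Cᴴ Z⁻¹ C = R`. -/
structure IsMaxSol (C R Z : Matrix n n 𝕜) : Prop where
  posDef : Z.PosDef
  eq : R - Cᴴ * Z⁻¹ * C = Z
  tendsto : Filter.Tendsto (fpi C R) Filter.atTop (nhds Z)

theorem IsMaxSol.fpi_posDef {C R Z : Matrix n n 𝕜} (h : IsMaxSol C R Z) (k : ℕ) :
    (fpi C R k).PosDef :=
  posDef_of_le h.posDef
    (fpi_sub_posSemidef h.posDef (by simp [h.eq, Matrix.PosSemidef.zero]) k)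

theorem IsMaxSol.specRadius_le_one {C R Z : Matrix n n 𝕜} (h : IsMaxSol C R Z) :
    specRadius (Z⁻¹ * C) ≤ 1 := by
  rw [specRadius_le_one_iff]
  intro μ hμ
  have hD := fpi_dual_sub_posDef h.posDef h.eq
  refine norm_le_one_of_gramian (Z := toComplex Z) (T := toComplex (Z⁻¹ * C))
    (D := fun k => toComplex (fpi Cᴴ R k + Z - R)) (posDef_toComplex.2 h.posDef)
    (fun k => posDef_toComplex.2 (hD k)) (by simp [fpi]) (fun k => ?_) ?_ hμ
  · rw [← toComplex_inv (hD (k + 1)).isUnit, ← toComplex_inv (hD k).isUnit,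
      ← toComplex_inv h.posDef.isUnit, fpi_dual_sub_inv h.posDef h.eq, toComplex_add,
      toComplex_mul, toComplex_mul, toComplex_conjTranspose]
  · simp only [← toComplex_pow, ← toComplex_conjTranspose, ← toComplex_mul,
      ← fpi_sub_eq h.posDef h.eq h.fpi_posDef]
    have := h.tendsto.sub_const Z
    rw [sub_self] at this
    have h2 := (continuous_toComplex.tendsto (0 : Matrix n n 𝕜)).comp this
    have h0 : toComplex (0 : Matrix n n 𝕜) = 0 := by simp only [toComplex_eq, map_zero]
    rwa [h0] at h2

theorem specRadius_conjTranspose_le_one {M : Matrix n n 𝕜} (h : specRadius Mᴴ ≤ 1) :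
    specRadius M ≤ 1 := by
  rw [specRadius_le_one_iff] at h ⊢
  intro μ hμ
  simpa using h _ (spec_conjTranspose.2 hμ)

section Dual

variable {C R Z W : Matrix n n 𝕜}

theorem conjTranspose_matS (hW : W.PosDef) : (C * W⁻¹)ᴴ = W⁻¹ * Cᴴ := by
  rw [Matrix.conjTranspose_mul, hW.inv.isHermitian.eq]

theorem IsMaxSol.dual_eq (h : IsMaxSol Cᴴ R W) : R - C * W⁻¹ * Cᴴ = W := by
  simpa using h.eq

theorem IsMaxSol.dual_specRadius_le_one (h : IsMaxSol Cᴴ R W) : specRadius (C * W⁻¹) ≤ 1 :=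
  specRadius_conjTranspose_le_one (by
    rw [conjTranspose_matS h.posDef]; exact h.specRadius_le_one)

theorem spec_eq (hZ : IsMaxSol C R Z) (hW : IsMaxSol Cᴴ R W) :
    spec (Z⁻¹ * C) = spec (C * W⁻¹) := by
  refine (spec_subset_of_dual hZ.posDef hW.posDef hZ.eq hW.dual_eq hZ.specRadius_le_one
    hW.dual_specRadius_le_one).antisymm ?_
  have h := spec_subset_of_dual (C := Cᴴ) hW.posDef hZ.posDef hW.eq
    (by simpa using hZ.eq) hW.specRadius_le_one
    (specRadius_conjTranspose_le_one (by
      rw [conjTranspose_matS hZ.posDef]; simpa using hZ.specRadius_le_one))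
  intro μ hμ
  rw [← spec_conjTranspose, conjTranspose_matS hW.posDef] at hμ
  have h2 := h hμ
  rw [← spec_conjTranspose, conjTranspose_matS hZ.posDef] at h2
  simpa using h2

theorem matT_mul_matS (hZ : IsMaxSol C R Z) (hW : IsMaxSol Cᴴ R W) :
    Z⁻¹ * C * (C * W⁻¹)ᴴ = 1 - Z⁻¹ * (Z + W - R) := by
  rw [conjTranspose_matS hW.posDef]
  linear_combination (norm := noncomm_ring) -Z⁻¹ * hW.dual_eq + inv_mul_self hZ.posDef.isUnit

theorem sub_mul_matT (hZ : IsMaxSol C R Z) (hW : IsMaxSol Cᴴ R W) :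
    (Z + W - R) * (Z⁻¹ * C) = C * W⁻¹ * (Z + W - R) := by
  have e1 := mul_inv_self hZ.posDef.isUnit
  have e2 := inv_mul_self hW.posDef.isUnit
  linear_combination (norm := noncomm_ring) C * W⁻¹ * hZ.eq - hW.dual_eq * Z⁻¹ * C + e1 * C - C * e2

theorem tendsto_dual_sub (hW : IsMaxSol Cᴴ R W) :
    Filter.Tendsto (fun k => fpi Cᴴ R k + Z - R) Filter.atTop (nhds (Z + W - R)) := by
  rw [add_comm Z W]
  exact (hW.tendsto.add_const Z).sub_const R

theorem sub_posSemidef (hZ : IsMaxSol C R Z) (hW : IsMaxSol Cᴴ R W) : (Z + W - R).PosSemidef :=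
  posSemidef_of_tendsto (tendsto_dual_sub hW) fun k =>
    (fpi_dual_sub_posDef hZ.posDef hZ.eq k).posSemidef

theorem specRadius_lt_one_of_sub_posDef (hZ : IsMaxSol C R Z) (hW : IsMaxSol Cᴴ R W)
    (hD : (Z + W - R).PosDef) : specRadius (Z⁻¹ * C) < 1 := by
  refine specRadius_lt_one_of_stein hD ?_
  have h1 : ((Z + W - R)ᴴ * W⁻¹ * (Z + W - R)).PosDef :=
    hW.posDef.inv.conjTranspose_mul_mul_same
      (Matrix.mulVec_injective_iff_isUnit.2 hD.isUnit)
  convert h1 using 1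
  rw [Matrix.conjTranspose_mul, hZ.posDef.inv.isHermitian.eq, hD.isHermitian.eq, mul_assoc,
    sub_mul_matT hZ hW]
  have e1 := mul_inv_self hW.posDef.isUnit
  linear_combination (norm := noncomm_ring) hZ.eq * W⁻¹ * (Z + W - R) - e1 * (Z + W - R)

theorem sub_posDef_of_specRadius_lt_one (hZ : IsMaxSol C R Z) (hW : IsMaxSol Cᴴ R W)
    (h : specRadius (Z⁻¹ * C) < 1) : (Z + W - R).PosDef := by
  have hD := sub_posSemidef hZ hW
  have hS : specRadius (C * W⁻¹) < 1 := by rwa [← specRadius_eq_of_spec_eq (spec_eq hZ hW)]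
  have hker : ∀ x, (Z + W - R) *ᵥ x = 0 → x = 0 := by
    intro x hx
    have hconj : ∀ k, (Z + W - R) * (C * W⁻¹)ᴴ ^ k = (Z⁻¹ * C)ᴴ ^ k * (Z + W - R) := by
      intro k
      have h1 : SemiconjBy (Z + W - R) ((C * W⁻¹)ᴴ) ((Z⁻¹ * C)ᴴ) := by
        have := congrArg Matrix.conjTranspose (sub_mul_matT hZ hW)
        rw [Matrix.conjTranspose_mul, Matrix.conjTranspose_mul _ (Z + W - R),
          hD.isHermitian.eq] at this
        exact this.symm
      exact (h1.pow_right k).eq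
    have hfix : ∀ k, ((Z⁻¹ * C) ^ k * ((C * W⁻¹) ^ k)ᴴ) *ᵥ x = x := by
      intro k
      rw [Matrix.conjTranspose_pow]
      induction k with
      | zero => simp
      | succ k ih =>
        have h2 : (Z⁻¹ * C) ^ (k + 1) * (C * W⁻¹)ᴴ ^ (k + 1) =
            (Z⁻¹ * C) ^ k * (C * W⁻¹)ᴴ ^ k -
              (Z⁻¹ * C) ^ k * Z⁻¹ * (Z⁻¹ * C)ᴴ ^ k * (Z + W - R) := by
          rw [pow_succ, pow_succ' _ k]
          linear_combination (norm := noncomm_ring)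
            (Z⁻¹ * C) ^ k * matT_mul_matS hZ hW * (C * W⁻¹)ᴴ ^ k
              - (Z⁻¹ * C) ^ k * Z⁻¹ * hconj k
        rw [h2, Matrix.sub_mulVec, ih, ← Matrix.mulVec_mulVec x _ (Z + W - R), hx,
          Matrix.mulVec_zero, sub_zero]
    have hlim : Filter.Tendsto (fun k => ((Z⁻¹ * C) ^ k * ((C * W⁻¹) ^ k)ᴴ) *ᵥ x) Filter.atTop
        (nhds 0) := by
      have h1 := (tendsto_pow_of_specRadius_lt_one h).mul
        (((Continuous.matrix_conjTranspose continuous_id).tendsto (0 : Matrix n n 𝕜)).comp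
          (tendsto_pow_of_specRadius_lt_one hS))
      have h2 := ((Continuous.matrix_mulVec continuous_id
        (continuous_const (y := x))).tendsto (0 * ((0 : Matrix n n 𝕜)ᴴ))).comp h1
      rw [id, zero_mul, Matrix.zero_mulVec] at h2
      exact h2
    simp only [hfix] at hlim
    exact tendsto_nhds_unique tendsto_const_nhds hlim
  rw [hD.posDef_iff_isUnit, ← Matrix.mulVec_injective_iff_isUnit]
  intro x y hxy
  have h1 : (Z + W - R) *ᵥ (x - y) = 0 := by rw [Matrix.mulVec_sub, sub_eq_zero]; exact hxy
  exact sub_eq_zero.1 (hker _ h1)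

theorem norm_le_one_of_mem_spec_mul (hZ : IsMaxSol C R Z) (hW : IsMaxSol Cᴴ R W) {μ : ℂ}
    (hμ : μ ∈ spec (Z⁻¹ * C * (C * W⁻¹)ᴴ)) : ‖μ‖ ≤ 1 ∧ (‖μ‖ = 1 → μ = 1) := by
  obtain ⟨x, hx, hKx⟩ := mem_spectrum_iff_exists.1 hμ
  have h1 := (posDef_toComplex.2 hZ.posDef).dotProduct_mulVec_pos hx
  have h2 := (posSemidef_toComplex.2 (sub_posSemidef hZ hW)).dotProduct_mulVec_nonneg x
  have h3 := (posSemidef_toComplex.2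
    (hW.posDef.inv.posSemidef.mul_mul_conjTranspose_same C)).dotProduct_mulVec_nonneg x
  have e1 : Z + W - R = Z - Z * (Z⁻¹ * C * (C * W⁻¹)ᴴ) := by
    rw [matT_mul_matS hZ hW]
    linear_combination (norm := noncomm_ring)
      -mul_inv_self hZ.posDef.isUnit * (Z + W - R)
  have e2 : C * W⁻¹ * Cᴴ = Z * (Z⁻¹ * C * (C * W⁻¹)ᴴ) := by
    rw [conjTranspose_matS hW.posDef]
    linear_combination (norm := noncomm_ring)
      -mul_inv_self hZ.posDef.isUnit * C * W⁻¹ * Cᴴ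
  rw [e1, toComplex_sub, toComplex_mul, Matrix.sub_mulVec, ← Matrix.mulVec_mulVec, hKx,
    Matrix.mulVec_smul, dotProduct_sub, dotProduct_smul, smul_eq_mul] at h2
  rw [e2, toComplex_mul, ← Matrix.mulVec_mulVec, hKx, Matrix.mulVec_smul, dotProduct_smul,
    smul_eq_mul] at h3
  set ζ := star x ⬝ᵥ (toComplex Z *ᵥ x)
  have h4 : 0 ≤ μ := le_of_mul_le_mul_right (by rwa [zero_mul]) h1
  have h5 : μ ≤ 1 := by
    refine le_of_mul_le_mul_right ?_ h1
    rw [one_mul]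
    exact sub_nonneg.1 h2
  have h6 : μ = (‖μ‖ : ℂ) := (Complex.norm_of_nonneg' h4).symm
  refine ⟨?_, fun h => by rw [h6, h]; simp⟩
  rw [h6] at h5
  exact_mod_cast h5

theorem one_mem_spec_mul_iff (hZ : IsMaxSol C R Z) (hW : IsMaxSol Cᴴ R W) :
    (1 : ℂ) ∈ spec (Z⁻¹ * C * (C * W⁻¹)ᴴ) ↔ ¬ IsUnit (Z + W - R) := by
  rw [matT_mul_matS hZ hW, spec, spectrum.mem_iff, map_one, ← toComplex_one (𝕜 := 𝕜),
    ← toComplex_sub, isUnit_toComplex, sub_sub_cancel, not_iff_not]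
  refine ⟨fun h => ?_, fun h => (isUnit_inv hZ.posDef.isUnit).mul h⟩
  have := hZ.posDef.isUnit.mul h
  rwa [← mul_assoc, mul_inv_self hZ.posDef.isUnit, one_mul] at this

theorem specRadius_mul_le_one (hZ : IsMaxSol C R Z) (hW : IsMaxSol Cᴴ R W) :
    specRadius (Z⁻¹ * C * (C * W⁻¹)ᴴ) ≤ 1 :=
  specRadius_le_one_iff.2 fun _ hμ => (norm_le_one_of_mem_spec_mul hZ hW hμ).1

theorem specRadius_mul_lt_one_iff (hZ : IsMaxSol C R Z) (hW : IsMaxSol Cᴴ R W) :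
    specRadius (Z⁻¹ * C * (C * W⁻¹)ᴴ) < 1 ↔ (Z + W - R).PosDef := by
  rw [(sub_posSemidef hZ hW).posDef_iff_isUnit, ← not_iff_not, ← one_mem_spec_mul_iff hZ hW,
    specRadius_lt_one_iff]
  constructor
  · intro h
    push Not at h
    obtain ⟨μ, hμ, hμ1⟩ := h
    obtain ⟨h1, h2⟩ := norm_le_one_of_mem_spec_mul hZ hW hμ
    rwa [h2 (le_antisymm h1 hμ1)] at hμ
  · intro h h'
    simpa using h' 1 h

omit [DecidableEq n] in
theorem finrank_ker_add_rank (M : Matrix n n 𝕜) :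
    Module.finrank 𝕜 (LinearMap.ker M.mulVecLin) + M.rank = Fintype.card n := by
  rw [add_comm, Matrix.rank, LinearMap.finrank_range_add_finrank_ker, Module.finrank_pi]

/-- The algebraic multiplicity of `1` as an eigenvalue of `1 - H` is the dimension of the kernel
of the Hermitian matrix `H`. -/
theorem finrank_ker_eq_rootMultiplicity {H : Matrix n n 𝕜} (hH : H.IsHermitian) :
    Module.finrank 𝕜 (LinearMap.ker H.mulVecLin) = (1 - H).charpoly.rootMultiplicity 1 := by
  have h1 : (1 - H).charpoly = ∏ i, (Polynomial.X - Polynomial.C (1 - (hH.eigenvalues i : 𝕜))) := by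
    have h2 : 1 - H = Unitary.conjStarAlgAut 𝕜 _ hH.eigenvectorUnitary
        (Matrix.diagonal fun i => 1 - (hH.eigenvalues i : 𝕜)) := by
      have h3 : (Matrix.diagonal fun i => 1 - (hH.eigenvalues i : 𝕜)) =
          1 - Matrix.diagonal (RCLike.ofReal ∘ hH.eigenvalues) := by
        rw [← Matrix.diagonal_one, Matrix.diagonal_sub]
        rfl
      rw [h3, map_sub, map_one, ← hH.spectral_theorem]
    rw [h2, Unitary.conjStarAlgAut_apply, Matrix.charpoly_mul_comm, ← mul_assoc]
    simp [Matrix.charpoly_diagonal]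
  have h4 : (1 - H).charpoly.rootMultiplicity 1 =
      (Finset.univ.filter fun i => hH.eigenvalues i = 0).card := by
    rw [← Polynomial.count_roots, h1, Polynomial.roots_prod _ _
      (Finset.prod_ne_zero_iff.2 fun i _ => Polynomial.X_sub_C_ne_zero _)]
    simp only [Polynomial.roots_X_sub_C, Multiset.bind_singleton, Multiset.count_map]
    rw [Finset.card_def, Finset.filter_val]
    congr 1
    refine Multiset.filter_congr fun i _ => ?_
    simp [eq_comm (a := (1 : 𝕜))]
  have h5 := finrank_ker_add_rank H
  rw [hH.rank_eq_card_non_zero_eigs, Fintype.card_subtype] at h5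
  have h6 := Finset.card_filter_add_card_filter_not (s := Finset.univ)
    (fun i => hH.eigenvalues i = 0)
  rw [Finset.card_univ] at h6
  rw [h4]
  simp only [ne_eq] at h5
  omega

theorem finrank_ker_sub_eq (hZ : IsMaxSol C R Z) (hW : IsMaxSol Cᴴ R W) :
    Module.finrank 𝕜 (LinearMap.ker (Z + W - R).mulVecLin) =
      (Z⁻¹ * C * (C * W⁻¹)ᴴ).charpoly.rootMultiplicity 1 := by
  obtain ⟨B, hB⟩ := exists_eq_conjTranspose_mul_self hZ.posDef.posSemidef
  have hBu : IsUnit B := by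
    have := hZ.posDef.isUnit
    rw [hB, Matrix.isUnit_iff_isUnit_det, Matrix.det_mul] at this
    exact (Matrix.isUnit_iff_isUnit_det B).2 (isUnit_of_mul_isUnit_right this)
  have e1 := mul_inv_self hBu
  have e2 := inv_mul_self hBu
  have hBi : (Z : Matrix n n 𝕜)⁻¹ = B⁻¹ * B⁻¹ᴴ := by
    rw [hB, Matrix.mul_inv_rev, Matrix.conjTranspose_nonsing_inv]
  set D := Z + W - R with hD
  set H := B⁻¹ᴴ * D * B⁻¹ with hH
  have hHh : H.IsHermitian := ((sub_posSemidef hZ hW).conjTranspose_mul_mul_same B⁻¹).isHermitian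
  have hrank : H.rank = D.rank := by
    have hd : IsUnit (B⁻¹).det := (Matrix.isUnit_iff_isUnit_det _).1 (isUnit_inv hBu)
    have hd' : IsUnit (B⁻¹ᴴ).det := by rw [Matrix.det_conjTranspose]; exact hd.star
    rw [hH, Matrix.rank_mul_eq_left_of_isUnit_det _ _ hd,
      Matrix.rank_mul_eq_right_of_isUnit_det _ _ hd']
  have hchar : (Z⁻¹ * C * (C * W⁻¹)ᴴ).charpoly = (1 - H).charpoly := by
    have h1 : Z⁻¹ * C * (C * W⁻¹)ᴴ = B⁻¹ * ((1 - H) * B) := by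
      rw [matT_mul_matS hZ hW, ← hD, hBi, hH]
      linear_combination (norm := noncomm_ring) B⁻¹ * B⁻¹ᴴ * D * e2 - e2
    rw [h1, Matrix.charpoly_mul_comm, mul_assoc, e1, mul_one]
  rw [hchar, ← finrank_ker_eq_rootMultiplicity hHh]
  have h1 := finrank_ker_add_rank H
  have h2 := finrank_ker_add_rank D
  omega

end Dual

end Reduced

section ReducedRates

variable {𝕜 : Type*} [RCLike 𝕜] {n : Type*} [Fintype n] [DecidableEq n] {C R Z W : Matrix n n 𝕜}

theorem specRadius_conjTranspose (M : Matrix n n 𝕜) : specRadius Mᴴ = specRadius M := by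
  have key : ∀ M : Matrix n n 𝕜, specRadius M ≤ specRadius Mᴴ := by
    intro M
    refine iSup₂_le fun μ hμ => ?_
    have h1 : star μ ∈ spec Mᴴ := spec_conjTranspose.2 hμ
    have h2 : (‖star μ‖₊ : ℝ≥0∞) ≤ specRadius Mᴴ :=
      le_iSup₂ (f := fun (k : ℂ) (_ : k ∈ spec Mᴴ) => (‖k‖₊ : ℝ≥0∞)) _ h1
    rwa [nnnorm_star] at h2
  refine le_antisymm ?_ (key M)
  simpa using key Mᴴ

theorem specRadius_dual_eq (hZ : IsMaxSol C R Z) (hW : IsMaxSol Cᴴ R W) :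
    specRadius (W⁻¹ * Cᴴ) = specRadius (Z⁻¹ * C) := by
  rw [← conjTranspose_matS hW.posDef, specRadius_conjTranspose,
    specRadius_eq_of_spec_eq (spec_eq hZ hW)]

theorem exists_le_coup (hZ : IsMaxSol C R Z) (hW : IsMaxSol Cᴴ R W)
    (N : Seminorm 𝕜 (Matrix n n 𝕜)) :
    ∃ c, 0 < c ∧ ∀ k, N (coup C R k) ≤ c * entryNorm ((Z⁻¹ * C) ^ (k + 1)) ^ 1 := by
  obtain ⟨c, hc, h⟩ := seminorm_le_entryNorm N
  obtain ⟨d, hd, h'⟩ := exists_entryNorm_le_of_tendsto (tendsto_dual_sub (Z := Z) hW)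
  refine ⟨c * d, by positivity, fun k => (h _).trans ?_⟩
  rw [coup_eq hZ.posDef hZ.eq, mul_assoc, pow_one]
  refine mul_le_mul_of_nonneg_left ((entryNorm_mul_le _ _).trans ?_) hc.le
  exact mul_le_mul_of_nonneg_right (h' k) (entryNorm_nonneg _)

theorem exists_le_fpi_sub (hZ : IsMaxSol C R Z) (hW : IsMaxSol Cᴴ R W)
    (N : Seminorm 𝕜 (Matrix n n 𝕜)) :
    ∃ c, 0 < c ∧ ∀ k, N (fpi C R k - Z) ≤ c * entryNorm ((Z⁻¹ * C) ^ (k + 1)) ^ 2 := by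
  obtain ⟨c, hc, h⟩ := seminorm_le_entryNorm N
  obtain ⟨d, hd, h'⟩ := exists_entryNorm_le_of_tendsto (tendsto_dual_sub (Z := Z) hW)
  refine ⟨c * d, by positivity, fun k => (h _).trans ?_⟩
  rw [fpi_sub_eq hZ.posDef hZ.eq hZ.fpi_posDef, mul_assoc c]
  refine mul_le_mul_of_nonneg_left ((entryNorm_mul_le _ _).trans ?_) hc.le
  have h0 := entryNorm_nonneg ((Z⁻¹ * C) ^ (k + 1))
  have h1 := entryNorm_mul_le ((Z⁻¹ * C) ^ (k + 1))ᴴ (fpi Cᴴ R k + Z - R)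
  rw [entryNorm_conjTranspose] at h1
  have h2 := mul_le_mul_of_nonneg_left (h' k) h0
  calc _ ≤ entryNorm ((Z⁻¹ * C) ^ (k + 1)) * d * entryNorm ((Z⁻¹ * C) ^ (k + 1)) :=
        mul_le_mul_of_nonneg_right (h1.trans h2) h0
    _ = _ := by ring

theorem exists_le_fpi_dual_sub (hZ : IsMaxSol C R Z) (hW : IsMaxSol Cᴴ R W)
    (N : Seminorm 𝕜 (Matrix n n 𝕜)) :
    ∃ c, 0 < c ∧ ∀ k, N (fpi Cᴴ R k - W) ≤ c * entryNorm ((W⁻¹ * Cᴴ) ^ (k + 1)) ^ 2 :=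
  exists_le_fpi_sub hW (by simpa using hZ) N

theorem IsMaxSol.exists_dual (hZ : IsMaxSol C R Z) : ∃ W, IsMaxSol Cᴴ R W := by
  obtain ⟨W, h1, h2, h3⟩ := exists_dual_solution hZ.posDef hZ.eq hZ.tendsto
  exact ⟨W, h1, by simpa using h2, h3⟩

theorem specRadius_lt_one_of_strict_subsolution {V P : Matrix n n 𝕜} (hV : V.PosDef)
    (hP : P.PosDef) (hsub : R - Cᴴ * V⁻¹ * C = V + P) (hZ : Z.PosDef)
    (hs : R - Cᴴ * Z⁻¹ * C = Z) (hZV : (Z - V).PosDef) : specRadius (Z⁻¹ * C) < 1 := by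
  refine specRadius_lt_one_of_stein hZV ?_
  have h1 := hP.add_posSemidef
    (hV.inv.posSemidef.conjTranspose_mul_mul_same ((Z - V) * (Z⁻¹ * C)))
  convert h1 using 1
  simp only [Matrix.conjTranspose_mul, hZV.isHermitian.eq, hZ.inv.isHermitian.eq]
  have e1 := mul_inv_self hZ.isUnit
  have e1' := inv_mul_self hZ.isUnit
  have e2 := mul_inv_self hV.isUnit
  have e2' := inv_mul_self hV.isUnit
  have k1 : (Z - V) * (Z⁻¹ * C) = C - V * Z⁻¹ * C := by
    linear_combination (norm := noncomm_ring) e1 * C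
  have k2 : Cᴴ * Z⁻¹ * (Z - V) = Cᴴ - Cᴴ * Z⁻¹ * V := by
    linear_combination (norm := noncomm_ring) Cᴴ * e1'
  rw [k1, k2]
  linear_combination (norm := noncomm_ring) hsub - hs + Cᴴ * e2' * Z⁻¹ * C + Cᴴ * Z⁻¹ * e2 * C
    - Cᴴ * Z⁻¹ * e2 * V * Z⁻¹ * C

theorem eq_of_specRadius_lt_one {Z' : Matrix n n 𝕜} (hZ : Z.PosDef) (hZ' : Z'.PosDef)
    (hs : R - Cᴴ * Z⁻¹ * C = Z) (hs' : R - Cᴴ * Z'⁻¹ * C = Z')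
    (h : specRadius (Z⁻¹ * C) < 1) (h' : specRadius (Z'⁻¹ * C) < 1) : Z = Z' := by
  have e1 := mul_inv_self hZ.isUnit
  have e1' := inv_mul_self hZ'.isUnit
  have hstep : Z - Z' = (Z'⁻¹ * C)ᴴ * (Z - Z') * (Z⁻¹ * C) := by
    rw [Matrix.conjTranspose_mul, hZ'.inv.isHermitian.eq]
    linear_combination (norm := noncomm_ring) hs' - hs - Cᴴ * Z'⁻¹ * e1 * C + Cᴴ * e1' * Z⁻¹ * C
  have hk : ∀ k, Z - Z' = ((Z'⁻¹ * C) ^ k)ᴴ * (Z - Z') * (Z⁻¹ * C) ^ k := by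
    intro k
    induction k with
    | zero => simp
    | succ k ih =>
      rw [pow_succ' _ k, pow_succ' (Z⁻¹ * C), Matrix.conjTranspose_mul]
      linear_combination (norm := noncomm_ring) ih +
        ((Z'⁻¹ * C) ^ k)ᴴ * hstep * (Z⁻¹ * C) ^ k
  have h1 := (((((Continuous.matrix_conjTranspose continuous_id).tendsto (0 : Matrix n n 𝕜)).comp
    (tendsto_pow_of_specRadius_lt_one h')).mul_const (Z - Z'))).mul
      (tendsto_pow_of_specRadius_lt_one h)
  rw [mul_zero] at h1
  have h2 : Filter.Tendsto (fun _ : ℕ => Z - Z') Filter.atTop (nhds 0) :=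
    h1.congr fun k => (hk k).symm
  exact sub_eq_zero.1 (tendsto_nhds_unique tendsto_const_nhds h2)

end ReducedRates

section Admissible

variable {𝕜 : Type*} [RCLike 𝕜] {n : Type*} [Fintype n] [DecidableEq n]
  {f : Matrix n n 𝕜 → Matrix n n 𝕜}

theorem IsAdmissible.map_one (hf : IsAdmissible f) : f 1 = 1 := by
  have := hf.map_mul (f 1) 1
  rw [mul_one, hf.period_two, one_mul] at this
  exact this.symm

omit [DecidableEq n] in
theorem IsAdmissible.map_zero (hf : IsAdmissible f) : f 0 = 0 := by
  have := hf.map_add 0 0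
  rw [add_zero] at this
  exact left_eq_add.1 this

/-- An admissible operator is a ring homomorphism. -/
def IsAdmissible.ringHom (hf : IsAdmissible f) : Matrix n n 𝕜 →+* Matrix n n 𝕜 where
  toFun := f
  map_one' := hf.map_one
  map_zero' := hf.map_zero
  map_add' := hf.map_add
  map_mul' := hf.map_mul

theorem IsAdmissible.map_sub (hf : IsAdmissible f) (X Y : Matrix n n 𝕜) :
    f (X - Y) = f X - f Y := _root_.map_sub hf.ringHom X Y

theorem IsAdmissible.map_neg (hf : IsAdmissible f) (X : Matrix n n 𝕜) : f (-X) = -f X :=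
  _root_.map_neg hf.ringHom X

theorem IsAdmissible.map_zsmul (hf : IsAdmissible f) (k : ℤ) (X : Matrix n n 𝕜) :
    f (k • X) = k • f X := _root_.map_zsmul hf.ringHom k X

theorem IsAdmissible.isUnit_map (hf : IsAdmissible f) {X : Matrix n n 𝕜} (h : IsUnit X) :
    IsUnit (f X) := h.map hf.ringHom

theorem IsAdmissible.isUnit_map_iff (hf : IsAdmissible f) {X : Matrix n n 𝕜} :
    IsUnit (f X) ↔ IsUnit X :=
  ⟨fun h => by simpa [hf.period_two] using hf.isUnit_map h, hf.isUnit_map⟩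

theorem IsAdmissible.map_inv (hf : IsAdmissible f) {X : Matrix n n 𝕜} (h : IsUnit X) :
    f X⁻¹ = (f X)⁻¹ := by
  symm
  apply Matrix.inv_eq_right_inv
  rw [← hf.map_mul, mul_inv_self h, hf.map_one]

theorem IsAdmissible.map_posDef (hf : IsAdmissible f) {X : Matrix n n 𝕜} (h : X.PosDef) :
    (f X).PosDef :=
  (hf.map_nonneg X h.posSemidef).posDef_iff_isUnit.2 (hf.isUnit_map h.isUnit)

theorem IsAdmissible.map_isHermitian (hf : IsAdmissible f) {H : Matrix n n 𝕜}
    (hH : H.IsHermitian) : (f H).IsHermitian := by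
  have h1 : (f ((H + 1) * (H + 1))).IsHermitian := by
    refine (hf.map_nonneg _ ?_).isHermitian
    have := Matrix.posSemidef_conjTranspose_mul_self (H + 1)
    rwa [Matrix.conjTranspose_add, hH.eq, Matrix.conjTranspose_one] at this
  have h2 : (f ((H - 1) * (H - 1))).IsHermitian := by
    refine (hf.map_nonneg _ ?_).isHermitian
    have := Matrix.posSemidef_conjTranspose_mul_self (H - 1)
    rwa [Matrix.conjTranspose_sub, hH.eq, Matrix.conjTranspose_one] at this
  have h3 := h1.sub h2
  rw [← hf.map_sub] at h3
  have h4 : (H + 1) * (H + 1) - (H - 1) * (H - 1) = (4 : ℤ) • H := by noncomm_ring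
  rw [h4, hf.map_zsmul, Matrix.IsHermitian, Matrix.conjTranspose_zsmul] at h3
  ext i j
  simpa using congrFun (congrFun h3 i) j

theorem IsAdmissible.map_imaginary (hf : IsAdmissible f) :
    (f (Matrix.scalar n (RCLike.I : 𝕜)))ᴴ = f (Matrix.scalar n (RCLike.I : 𝕜))ᴴ := by
  rcases RCLike.I_mul_I_ax (K := 𝕜) with h0 | h0
  · simp [h0, hf.map_zero]
  have hcomm : ∀ M, Commute (f (Matrix.scalar n (RCLike.I : 𝕜))) M := by
    intro M
    have h1 := (Matrix.scalar_commute (RCLike.I : 𝕜) (fun r => Commute.all _ r) (f M)).eq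
    have h2 := congrArg f h1
    rwa [hf.map_mul, hf.map_mul, hf.period_two] at h2
  obtain ⟨z, hz⟩ := Matrix.mem_range_scalar_of_commute_single
    (M := f (Matrix.scalar n (RCLike.I : 𝕜))) (fun i j _ => (hcomm _).symm)
  have hstar : (Matrix.scalar n (RCLike.I : 𝕜))ᴴ = -Matrix.scalar n (RCLike.I : 𝕜) := by
    simp
  rw [hstar, hf.map_neg, ← hz]
  have hzz : Matrix.scalar n (z * z) = Matrix.scalar n (-1) := by
    rw [_root_.map_mul, hz, ← hf.map_mul, ← _root_.map_mul, h0, _root_.map_neg, _root_.map_one,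
      hf.map_neg, hf.map_one]
  rcases isEmpty_or_nonempty n with hn | hn
  · exact Subsingleton.elim _ _
  have h1 : z * z = RCLike.I * RCLike.I := by rw [h0]; exact Matrix.scalar_inj.1 hzz
  rcases mul_self_eq_mul_self_iff.1 h1 with h | h <;> simp [h]

theorem IsAdmissible.map_conjTranspose (hf : IsAdmissible f) (X : Matrix n n 𝕜) :
    f Xᴴ = (f X)ᴴ := by
  have hherm : ∀ H : Matrix n n 𝕜, H.IsHermitian → f Hᴴ = (f H)ᴴ := fun H hH => by
    rw [hH.eq, (hf.map_isHermitian hH).eq]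
  have hadd : ∀ M N : Matrix n n 𝕜, f Mᴴ = (f M)ᴴ → f Nᴴ = (f N)ᴴ → f (M + N)ᴴ = (f (M + N))ᴴ := by
    intro M N hM hN
    rw [Matrix.conjTranspose_add, hf.map_add, hf.map_add, hM, hN, Matrix.conjTranspose_add]
  have hmul : ∀ M N : Matrix n n 𝕜, f Mᴴ = (f M)ᴴ → f Nᴴ = (f N)ᴴ → f (M * N)ᴴ = (f (M * N))ᴴ := by
    intro M N hM hN
    rw [Matrix.conjTranspose_mul, hf.map_mul, hf.map_mul, hM, hN, Matrix.conjTranspose_mul]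
  have hreal : ∀ (i j : n) (r : ℝ), f (Matrix.single i j (r : 𝕜))ᴴ = (f (Matrix.single i j (r : 𝕜)))ᴴ := by
    intro i j r
    by_cases hij : i = j
    · subst hij
      exact hherm _ (by simp [Matrix.IsHermitian, Matrix.conjTranspose_single])
    · have h1 : Matrix.single i j (r : 𝕜) = Matrix.single i i 1 *
          (Matrix.single i j (r : 𝕜) + Matrix.single j i (r : 𝕜)) := by
        rw [mul_add, Matrix.single_mul_single_same, one_mul,
          Matrix.single_mul_single_of_ne _ _ _ _ hij, add_zero]
      rw [h1]
      refine hmul _ _ (hherm _ ?_) (hherm _ ?_)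
      · simp [Matrix.IsHermitian, Matrix.conjTranspose_single]
      · simp [Matrix.IsHermitian, Matrix.conjTranspose_single, add_comm]
  have hsingle : ∀ (i j : n) (c : 𝕜), f (Matrix.single i j c)ᴴ = (f (Matrix.single i j c))ᴴ := by
    intro i j c
    have h1 : Matrix.single i j c = Matrix.single i j ((RCLike.re c : ℝ) : 𝕜) +
        Matrix.single i j ((RCLike.im c : ℝ) : 𝕜) * Matrix.scalar n (RCLike.I : 𝕜) := by
      conv_lhs => rw [← RCLike.re_add_im c, Matrix.single_add]
      congr 1
      ext a b
      simp [Matrix.single_apply, Matrix.mul_diagonal]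
    rw [h1]
    exact hadd _ _ (hreal _ _ _) (hmul _ _ (hreal _ _ _) hf.map_imaginary.symm)
  refine Matrix.induction_on' (P := fun X => f Xᴴ = (f X)ᴴ) X ?_ hadd hsingle
  simp [hf.map_zero]

end Admissible

section Original

variable {𝕜 : Type*} [RCLike 𝕜] {n : Type*} [Fintype n] [DecidableEq n]
  {f : Matrix n n 𝕜 → Matrix n n 𝕜} {s : Sgn} {A Q X Z W : Matrix n n 𝕜}

theorem Sgn.val_mul_val (s : Sgn) : s.val * s.val = 1 := by cases s <;> rfl

/-- The right-hand side of the equation `X = Q ∓ Aᴴ f(X)⁻¹ A`. -/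
def phi (s : Sgn) (f : Matrix n n 𝕜 → Matrix n n 𝕜) (A Q X : Matrix n n 𝕜) : Matrix n n 𝕜 :=
  Q - s.val • (Aᴴ * (f X)⁻¹ * A)

/-- The constant term of the reduced equation. -/
def redR (s : Sgn) (f : Matrix n n 𝕜 → Matrix n n 𝕜) (A Q : Matrix n n 𝕜) : Matrix n n 𝕜 :=
  (initial s f A Q).Q - (initial s f A Q).B

theorem isSolution_iff : IsSolution s f A Q X ↔ X.IsHermitian ∧ IsUnit (f X) ∧ phi s f A Q X = X := by
  rw [IsSolution, phi, sub_eq_iff_eq_add, eq_comm (b := Q)]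

theorem isDualSolution_iff :
    IsDualSolution s f A Q X ↔ IsSolution s f (f A)ᴴ Q X := by
  rw [isSolution_iff, IsDualSolution, phi, Matrix.conjTranspose_conjTranspose, eq_comm (a := X)]

theorem IsAdmissible.map_phi (hf : IsAdmissible f) (hX : IsUnit X) :
    f (phi s f A Q X) = f Q - s.val • ((f A)ᴴ * X⁻¹ * f A) := by
  rw [phi, hf.map_sub, hf.map_zsmul, hf.map_mul, hf.map_mul, hf.map_conjTranspose,
    hf.map_inv (hf.isUnit_map hX), hf.period_two]

theorem initial_A_conjTranspose (hf : IsAdmissible f) (hQ : Q.PosDef) :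
    (initial s f A Q).Aᴴ = Aᴴ * (f Q)⁻¹ * (f A)ᴴ := by
  simp only [initial, Matrix.conjTranspose_mul, (hf.map_posDef hQ).inv.isHermitian.eq, mul_assoc]

theorem sub_initial_B :
    X - (initial s f A Q).B = X - (s.val • f A) * (f Q)⁻¹ * (f A)ᴴ := by
  simp only [initial, smul_mul_assoc]

theorem map_phi_eq_sub (hf : IsAdmissible f) (hX : IsUnit X) :
    f (phi s f A Q X) = f Q - (f A)ᴴ * X⁻¹ * (s.val • f A) := by
  rw [hf.map_phi hX, mul_smul_comm]

theorem isUnit_map_phi (hf : IsAdmissible f) (hQ : IsUnit Q) (hX : IsUnit X)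
    (h : IsUnit (X - (initial s f A Q).B)) : IsUnit (f (phi s f A Q X)) := by
  rw [map_phi_eq_sub hf hX]
  rw [sub_initial_B] at h
  exact isUnit_schur (hf.isUnit_map hQ) hX h

theorem isUnit_sub_initial_B (hf : IsAdmissible f) (hQ : IsUnit Q) (hX : IsUnit X)
    (h : IsUnit (f (phi s f A Q X))) : IsUnit (X - (initial s f A Q).B) := by
  rw [map_phi_eq_sub hf hX] at h
  rw [sub_initial_B]
  exact isUnit_schur hX (hf.isUnit_map hQ) h

/-- Applying the fixed point map twice gives the reduced equation. -/
theorem phi_phi (hf : IsAdmissible f) (hQ : Q.PosDef) (hX : IsUnit X)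
    (h : IsUnit (X - (initial s f A Q).B)) :
    phi s f A Q (phi s f A Q X) = (initial s f A Q).Q -
      (initial s f A Q).Aᴴ * (X - (initial s f A Q).B)⁻¹ * (initial s f A Q).A := by
  have hw := woodbury (hf.isUnit_map hQ.isUnit) hX (sub_initial_B (s := s) (A := A) ▸ h)
  rw [← sub_initial_B, ← map_phi_eq_sub hf hX] at hw
  rw [phi, hw, initial_A_conjTranspose hf hQ]
  set E := (X - (initial s f A Q).B)⁻¹
  simp only [initial, mul_add, add_mul, smul_add, mul_smul_comm, smul_mul_assoc, smul_smul,
    s.val_mul_val, one_smul, mul_assoc]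
  abel

theorem phi_phi_eq_iff (hf : IsAdmissible f) (hQ : Q.PosDef) (hX : IsUnit X)
    (h : IsUnit (X - (initial s f A Q).B)) :
    phi s f A Q (phi s f A Q X) = X ↔
    redR s f A Q - (initial s f A Q).Aᴴ * (X - (initial s f A Q).B)⁻¹ * (initial s f A Q).A =
      X - (initial s f A Q).B := by
  rw [phi_phi hf hQ hX h, redR, ← sub_left_inj (a := (initial s f A Q).B)]
  abel_nf

theorem initial_B_isHermitian (hf : IsAdmissible f) (hQ : Q.PosDef) :
    (initial s f A Q).B.IsHermitian := by
  have := ((hf.map_posDef hQ).inv.posSemidef.mul_mul_conjTranspose_same (f A)).isHermitian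
  rw [Matrix.IsHermitian, initial, Matrix.conjTranspose_zsmul, this.eq]

/-- A Hermitian fixed point yields a Hermitian solution of the reduced equation. -/
theorem sub_posSemidef_of_phi_phi (hf : IsAdmissible f) (hQ : Q.PosDef)
    (hZ : IsMaxSol (initial s f A Q).A (redR s f A Q) Z) (hX : X.IsHermitian) (hXu : IsUnit X)
    (hu : IsUnit (f (phi s f A Q X))) (h : phi s f A Q (phi s f A Q X) = X) :
    (Z + (initial s f A Q).B - X).PosSemidef := by
  have hXB := isUnit_sub_initial_B hf hQ.isUnit hXu hu
  have := sub_posSemidef_of_solution (hX.sub (initial_B_isHermitian (s := s) (A := A) hf hQ)) hXB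
    ((phi_phi_eq_iff hf hQ hXu hXB).1 h) hZ.posDef hZ.eq hZ.tendsto
  convert this using 1
  abel

theorem sub_posSemidef_of_isSolution (hf : IsAdmissible f) (hQ : Q.PosDef)
    (hZ : IsMaxSol (initial s f A Q).A (redR s f A Q) Z) (hX : IsSolution s f A Q X) :
    (Z + (initial s f A Q).B - X).PosSemidef := by
  obtain ⟨h1, h2, h3⟩ := isSolution_iff.1 hX
  exact sub_posSemidef_of_phi_phi hf hQ hZ h1 (hf.isUnit_map_iff.1 h2) (by rwa [h3])
    (by rw [h3, h3])

theorem phi_phi_maxSol (hf : IsAdmissible f) (hQ : Q.PosDef)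
    (hZ : IsMaxSol (initial s f A Q).A (redR s f A Q) Z)
    (hX : IsUnit (Z + (initial s f A Q).B)) :
    IsUnit (f (phi s f A Q (Z + (initial s f A Q).B))) ∧
    phi s f A Q (phi s f A Q (Z + (initial s f A Q).B)) = Z + (initial s f A Q).B := by
  have h1 : Z + (initial s f A Q).B - (initial s f A Q).B = Z := add_sub_cancel_right _ _
  have hu : IsUnit (Z + (initial s f A Q).B - (initial s f A Q).B) := by
    rw [h1]; exact hZ.posDef.isUnit
  refine ⟨isUnit_map_phi hf hQ.isUnit hX hu, (phi_phi_eq_iff hf hQ hX hu).2 ?_⟩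
  rw [h1]
  exact hZ.eq

theorem maxSol_plus (hf : IsAdmissible f) (hQ : Q.PosDef)
    (hZ : IsMaxSol (initial Sgn.plus f A Q).A (redR Sgn.plus f A Q) Z) :
    (Z + (initial Sgn.plus f A Q).B).PosDef ∧
    phi Sgn.plus f A Q (Z + (initial Sgn.plus f A Q).B) = Z + (initial Sgn.plus f A Q).B := by
  have hB : (initial Sgn.plus f A Q).B = f A * (f Q)⁻¹ * (f A)ᴴ := by simp [initial, Sgn.val]
  have hq := hf.map_posDef hQ
  have hX : (Z + (initial Sgn.plus f A Q).B).PosDef := by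
    rw [hB]
    exact hZ.posDef.add_posSemidef (hq.inv.posSemidef.mul_mul_conjTranspose_same (f A))
  obtain ⟨hu, hpp⟩ := phi_phi_maxSol hf hQ hZ hX.isUnit
  refine ⟨hX, ?_⟩
  set X₀ := Z + (initial Sgn.plus f A Q).B with hX₀
  set X₁ := phi Sgn.plus f A Q X₀ with hX₁
  have hfX₁ : (f X₁).PosDef := by
    rw [hX₁, hf.map_phi hX.isUnit]
    have := schur_posDef (b := f A) hq hX (by rw [← hB, hX₀, add_sub_cancel_right]; exact hZ.posDef)
    simpa [Sgn.val] using this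
  have hX₁p : X₁.PosDef := by simpa [hf.period_two] using hf.map_posDef hfX₁
  have h1 : (X₀ - X₁).PosSemidef :=
    sub_posSemidef_of_phi_phi hf hQ hZ hX₁p.isHermitian hX₁p.isUnit
      (by rw [hpp]; exact hf.isUnit_map hX.isUnit) (by rw [hpp])
  have h2 := conj_inv_antitone A hfX₁ (by rw [← hf.map_sub]; exact hf.map_nonneg _ h1)
  have h3 : (X₁ - X₀).PosSemidef := by
    have h4 : X₁ = Q - Aᴴ * (f X₀)⁻¹ * A := by simp [hX₁, phi, Sgn.val]
    have h5 : phi Sgn.plus f A Q X₁ = Q - Aᴴ * (f X₁)⁻¹ * A := by simp [phi, Sgn.val]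
    convert h2 using 1
    linear_combination (norm := noncomm_ring) h4 - h5 + hpp
  open scoped MatrixOrder in exact le_antisymm (Matrix.le_iff.2 h1) (Matrix.le_iff.2 h3)

/-- For the minus sign the matrix `-B⁽¹⁾` is a strict subsolution of the reduced equation. -/
theorem minus_subsolution (hf : IsAdmissible f) (hQ : Q.PosDef) (hA : IsUnit A) :
    (-(initial Sgn.minus f A Q).B).PosDef ∧
    redR Sgn.minus f A Q - (initial Sgn.minus f A Q).Aᴴ * (-(initial Sgn.minus f A Q).B)⁻¹ *
      (initial Sgn.minus f A Q).A = -(initial Sgn.minus f A Q).B + Q := by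
  have hq := hf.map_posDef hQ
  have ha := hf.isUnit_map hA
  have hah : IsUnit (f A)ᴴ := (Matrix.isUnit_conjTranspose _).2 ha
  have hB : -(initial Sgn.minus f A Q).B = f A * (f Q)⁻¹ * (f A)ᴴ := by simp [initial, Sgn.val]
  have hBp : (-(initial Sgn.minus f A Q).B).PosDef := by
    rw [hB]
    exact (Matrix.IsUnit.posDef_star_right_conjugate_iff (x := (f Q)⁻¹) ha).2 hq.inv
  refine ⟨hBp, ?_⟩
  have hinv : (-(initial Sgn.minus f A Q).B)⁻¹ = (f A)ᴴ⁻¹ * f Q * (f A)⁻¹ := by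
    rw [hB, Matrix.mul_inv_rev, Matrix.mul_inv_rev, Matrix.nonsing_inv_nonsing_inv _
      ((Matrix.isUnit_iff_isUnit_det _).1 hq.isUnit), mul_assoc]
  rw [hinv, redR, initial_A_conjTranspose hf hQ]
  have e1 := mul_inv_self hah
  have e2 := inv_mul_self ha
  have e3 := inv_mul_self hq.isUnit
  simp only [initial, Sgn.val, neg_smul, one_smul, sub_neg_eq_add, neg_neg]
  linear_combination (norm := noncomm_ring)
    - Aᴴ * (f Q)⁻¹ * e1 * f Q * (f A)⁻¹ * f A * (f Q)⁻¹ * A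
    - Aᴴ * e3 * (f A)⁻¹ * f A * (f Q)⁻¹ * A - Aᴴ * e2 * (f Q)⁻¹ * A

theorem maxSol_minus (hf : IsAdmissible f) (hQ : Q.PosDef) (hA : IsUnit A)
    (hZ : IsMaxSol (initial Sgn.minus f A Q).A (redR Sgn.minus f A Q) Z) :
    (Z + (initial Sgn.minus f A Q).B).PosDef ∧
    phi Sgn.minus f A Q (Z + (initial Sgn.minus f A Q).B) = Z + (initial Sgn.minus f A Q).B ∧
    specRadius (Z⁻¹ * (initial Sgn.minus f A Q).A) < 1 := by
  obtain ⟨hB, hsub⟩ := minus_subsolution hf hQ hA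
  have h1 := sub_posSemidef_of_subsolution hB
    (by rw [hsub, add_sub_cancel_left]; exact hQ.posSemidef) hZ.tendsto
  have h2 := conj_inv_antitone (initial Sgn.minus f A Q).A hB h1
  have hX : (Z + (initial Sgn.minus f A Q).B).PosDef := by
    refine posDef_of_le hQ ?_
    convert h2 using 1
    linear_combination (norm := noncomm_ring) hsub - hZ.eq
  have hspec := specRadius_lt_one_of_strict_subsolution hB hQ hsub hZ.posDef hZ.eq
    (by rwa [sub_neg_eq_add])
  obtain ⟨hu, hpp⟩ := phi_phi_maxSol hf hQ hZ hX.isUnit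
  refine ⟨hX, ?_, hspec⟩
  set B := (initial Sgn.minus f A Q).B with hBdef
  set X₁ := phi Sgn.minus f A Q (Z + B) with hX₁
  have hX₁p : X₁.PosDef := by
    have h3 := hQ.add_posSemidef ((hf.map_posDef hX).inv.posSemidef.conjTranspose_mul_mul_same A)
    convert h3 using 1
    simp [hX₁, phi, Sgn.val]
  have hZ₁p : (X₁ - B).PosDef := by rw [sub_eq_add_neg]; exact hX₁p.add hB
  have hZ₁ := (phi_phi_eq_iff hf hQ hX₁p.isUnit hZ₁p.isUnit).1 (by rw [hpp])
  have hspec' := specRadius_lt_one_of_strict_subsolution hB hQ hsub hZ₁p hZ₁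
    (by rwa [sub_neg_eq_add, sub_add_cancel])
  have := eq_of_specRadius_lt_one hZ.posDef hZ₁p hZ.eq hZ₁ hspec hspec'
  rw [this, sub_add_cancel]

theorem isMaximalPosDef_of_isMaxSol (hf : IsAdmissible f) (hQ : Q.PosDef)
    (hA : s = Sgn.minus → IsUnit A)
    (hZ : IsMaxSol (initial s f A Q).A (redR s f A Q) Z) :
    IsMaximalPosDef (IsSolution s f A Q) (Z + (initial s f A Q).B) := by
  have key : (Z + (initial s f A Q).B).PosDef ∧
      phi s f A Q (Z + (initial s f A Q).B) = Z + (initial s f A Q).B := by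
    cases s with
    | plus => exact maxSol_plus hf hQ hZ
    | minus => exact ⟨(maxSol_minus hf hQ (hA rfl) hZ).1, (maxSol_minus hf hQ (hA rfl) hZ).2.1⟩
  exact ⟨isSolution_iff.2 ⟨key.1.isHermitian, hf.isUnit_map key.1.isUnit, key.2⟩, key.1,
    fun V hV => sub_posSemidef_of_isSolution hf hQ hZ hV⟩

theorem Standing.posDef (hs : Standing s f A Q) (hf : IsAdmissible f) : Q.PosDef := by
  cases s with
  | plus =>
    obtain ⟨X, hX, h⟩ := hs
    have h1 := (hX.add_posSemidef h).add_posSemidef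
      ((hf.map_posDef hX).inv.posSemidef.conjTranspose_mul_mul_same A)
    convert h1 using 1
    abel
  | minus => exact hs.1

theorem exists_isMaxSol (hf : IsAdmissible f) (hs : Standing s f A Q) :
    ∃ Z, IsMaxSol (initial s f A Q).A (redR s f A Q) Z := by
  have hQ := hs.posDef hf
  suffices h : ∃ V : Matrix n n 𝕜, V.PosDef ∧ (redR s f A Q - (initial s f A Q).Aᴴ * V⁻¹ *
      (initial s f A Q).A - V).PosSemidef by
    obtain ⟨V, hV, hsub⟩ := h
    obtain ⟨Z, h1, h2, h3⟩ := exists_maximal_solution hV hsub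
    exact ⟨Z, h1, h2, h3⟩
  cases s with
  | minus =>
    obtain ⟨hB, hsub⟩ := minus_subsolution hf hQ hs.2
    exact ⟨_, hB, by rw [hsub, add_sub_cancel_left]; exact hQ.posSemidef⟩
  | plus =>
    obtain ⟨X, hX, h⟩ := hs
    have hphi : phi Sgn.plus f A Q X = Q - Aᴴ * (f X)⁻¹ * A := by simp [phi, Sgn.val]
    rw [← hphi] at h
    have hfX := hf.map_posDef hX
    have hB : (initial Sgn.plus f A Q).B = f A * (f Q)⁻¹ * (f A)ᴴ := by simp [initial, Sgn.val]
    have h1 : (f (phi Sgn.plus f A Q X) - f X).PosSemidef := by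
      rw [← hf.map_sub]; exact hf.map_nonneg _ h
    have h2 : (f Q - (f A)ᴴ * X⁻¹ * f A).PosDef := by
      have := posDef_of_le hfX h1
      rw [hf.map_phi hX.isUnit] at this
      simpa [Sgn.val] using this
    have h3 : (X - (initial Sgn.plus f A Q).B).PosDef := by
      rw [hB]
      exact schur_posDef' hX (hf.map_posDef hQ) h2
    refine ⟨_, h3, ?_⟩
    have h4 := (conj_inv_antitone A hfX h1).add h
    convert h4 using 1
    have h5 := phi_phi hf hQ hX.isUnit h3.isUnit
    have h6 : phi Sgn.plus f A Q (phi Sgn.plus f A Q X) =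
        Q - Aᴴ * (f (phi Sgn.plus f A Q X))⁻¹ * A := by simp [phi, Sgn.val]
    rw [h6] at h5
    rw [redR]
    linear_combination (norm := noncomm_ring) -h5 - hphi

theorem dual_initial (hf : IsAdmissible f) (hQ : Q.PosDef) :
    (initial s f (f A)ᴴ Q).A = (initial s f A Q).Aᴴ ∧
    (initial s f (f A)ᴴ Q).B = Q - (initial s f A Q).Q ∧
    redR s f (f A)ᴴ Q = redR s f A Q := by
  have h1 : f (f A)ᴴ = Aᴴ := by rw [hf.map_conjTranspose, hf.period_two]
  refine ⟨?_, ?_, ?_⟩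
  · rw [initial_A_conjTranspose hf hQ]
    simp only [initial, h1]
  · simp only [initial, h1, Matrix.conjTranspose_conjTranspose, sub_sub_cancel]
  · simp only [redR, initial, h1, Matrix.conjTranspose_conjTranspose]
    abel

theorem isMaximalPosDef_dual (hf : IsAdmissible f) (hQ : Q.PosDef)
    (hA : s = Sgn.minus → IsUnit A)
    (hW : IsMaxSol (initial s f A Q).Aᴴ (redR s f A Q) W) :
    IsMaximalPosDef (IsDualSolution s f A Q) (Q - ((initial s f A Q).Q - W)) := by
  obtain ⟨h1, h2, h3⟩ := dual_initial (s := s) (A := A) hf hQ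
  rw [← h1, ← h3] at hW
  have h4 := isMaximalPosDef_of_isMaxSol hf hQ
    (fun h => (Matrix.isUnit_conjTranspose _).2 (hf.isUnit_map (hA h))) hW
  have h5 : IsDualSolution s f A Q = IsSolution s f (f A)ᴴ Q :=
    funext fun X => propext isDualSolution_iff
  rw [h5]
  convert h4 using 1
  rw [h2]
  abel

omit [Fintype n] [DecidableEq n] in
theorem IsMaximalPosDef.unique {sol : Matrix n n 𝕜 → Prop} {X Y : Matrix n n 𝕜}
    (hX : IsMaximalPosDef sol X) (hY : IsMaximalPosDef sol Y) : X = Y := by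
  have h1 := hX.2.2 Y hY.1
  have h2 := hY.2.2 X hX.1
  open scoped MatrixOrder in exact le_antisymm (Matrix.le_iff.2 h2) (Matrix.le_iff.2 h1)

theorem iter_eq (hZ : IsMaxSol (initial s f A Q).A (redR s f A Q) Z)
    (hW : IsMaxSol (initial s f A Q).Aᴴ (redR s f A Q) W) (k : ℕ) :
    iter s f A Q k = ⟨coup (initial s f A Q).A (redR s f A Q) k,
      (initial s f A Q).Q - fpi (initial s f A Q).Aᴴ (redR s f A Q) k,
      fpi (initial s f A Q).A (redR s f A Q) k + (initial s f A Q).B⟩ := by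
  induction k with
  | zero => simp [iter, coup, fpi, redR]
  | succ k ih =>
    rw [iter, ih, step, (coupled hZ.fpi_posDef hW.fpi_posDef k).2.1]
    simp only [sub_sub_cancel, coup, fpi, Matrix.conjTranspose_conjTranspose]
    congr 1
    · rw [redR]; abel
    · abel

end Original

end NME

end

theorem mainTheorem4 {𝕜 : Type*} [RCLike 𝕜] {n : Type*} [Fintype n] [DecidableEq n]
    (s : NME.Sgn) (f : Matrix n n 𝕜 → Matrix n n 𝕜)
    (hf : NME.IsAdmissible f) (hcont : Continuous f)
    (A Q : Matrix n n 𝕜) (hQ : Q.IsHermitian) (hs : NME.Standing s f A Q) :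
    -- the maximal solutions exist
    (∃ X, NME.IsMaximalPosDef (NME.IsSolution s f A Q) X) ∧
    (∃ Y, NME.IsMaximalPosDef (NME.IsDualSolution s f A Q) (Q - Y)) ∧
    ∀ X Y : Matrix n n 𝕜,
      NME.IsMaximalPosDef (NME.IsSolution s f A Q) X →
      NME.IsMaximalPosDef (NME.IsDualSolution s f A Q) (Q - Y) →
      -- `T₁` and `S₁` are well defined, their spectra agree, and the spectral radii are at most 1
      (IsUnit (X - (NME.initial s f A Q).B) ∧ IsUnit ((NME.initial s f A Q).Q - Y)) ∧
      NME.spec (NME.matT s f A Q X) = NME.spec (NME.matS s f A Q Y) ∧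
      NME.specRadius (NME.matT s f A Q X) ≤ 1 ∧
      NME.specRadius (NME.matT s f A Q X * (NME.matS s f A Q Y)ᴴ) ≤ 1 ∧
      -- (1)
      ((X - Y).PosDef ↔ NME.specRadius (NME.matT s f A Q X) < 1) ∧
      (NME.specRadius (NME.matT s f A Q X) < 1 ↔
        NME.specRadius (NME.matT s f A Q X * (NME.matS s f A Q Y)ᴴ) < 1) ∧
      -- (2)
      (s = NME.Sgn.minus →
        (X - Y).PosDef ∧ NME.specRadius (NME.matT s f A Q X) < 1) ∧
      -- (3)
      (s = NME.Sgn.plus →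
        (¬ IsUnit (X - Y) ↔ NME.specRadius (NME.matT s f A Q X) = 1) ∧
        (NME.specRadius (NME.matT s f A Q X) = 1 ↔
          (1 : ℂ) ∈ NME.spec (NME.matT s f A Q X * (NME.matS s f A Q Y)ᴴ)) ∧
        Module.finrank 𝕜 (LinearMap.ker (X - Y).mulVecLin) =
          (NME.matT s f A Q X * (NME.matS s f A Q Y)ᴴ).charpoly.rootMultiplicity 1) ∧
      -- (4) no breakdown of the iteration, its limits, and the rates, in every norm `N`
      (IsUnit (f Q) ∧ ∀ k, IsUnit ((NME.initial s f A Q).Q - (NME.iter s f A Q k).B)) ∧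
      Filter.Tendsto (fun k => (NME.iter s f A Q k).Q) Filter.atTop (nhds X) ∧
      Filter.Tendsto (fun k => (NME.iter s f A Q k).B) Filter.atTop (nhds Y) ∧
      ∀ N : Seminorm 𝕜 (Matrix n n 𝕜), (∀ M, N M = 0 → M = 0) →
        (NME.specRadius (NME.matT s f A Q X) < 1 →
          NME.RLinear N (fun k => (NME.iter s f A Q k).A) 0 ∧
          NME.RLinear N (fun k => (NME.iter s f A Q k).Q) X ∧
          NME.RLinear N (fun k => (NME.iter s f A Q k).B) Y) ∧
        NME.rootRate N (fun k => (NME.iter s f A Q k).A) ≤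
          NME.specRadius (NME.matT s f A Q X) ∧
        NME.rootRate N (fun k => (NME.iter s f A Q k).Q - X) ≤
          NME.specRadius (NME.matT s f A Q X) ^ 2 ∧
        NME.rootRate N (fun k => (Q - (NME.iter s f A Q k).B) - (Q - Y)) ≤
          NME.specRadius (NME.matT s f A Q X) ^ 2 := by

  classical
  have hQp := hs.posDef hf
  have hA : s = NME.Sgn.minus → IsUnit A := by
    rintro rfl
    exact hs.2
  obtain ⟨Z, hZ⟩ := NME.exists_isMaxSol hf hs
  obtain ⟨W, hW⟩ := hZ.exists_dual
  have hXm := NME.isMaximalPosDef_of_isMaxSol hf hQp hA hZ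
  have hYm := NME.isMaximalPosDef_dual hf hQp hA hW
  refine ⟨⟨_, hXm⟩, ⟨_, hYm⟩, fun X Y hX hY => ?_⟩
  obtain rfl : X = Z + (NME.initial s f A Q).B := hX.unique hXm
  obtain rfl : Y = (NME.initial s f A Q).Q - W := sub_right_injective (hY.unique hYm)
  have hT : NME.matT s f A Q (Z + (NME.initial s f A Q).B) = Z⁻¹ * (NME.initial s f A Q).A := by
    rw [NME.matT, add_sub_cancel_right]
  have hS : NME.matS s f A Q ((NME.initial s f A Q).Q - W) = (NME.initial s f A Q).A * W⁻¹ := by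
    rw [NME.matS, sub_sub_cancel]
  have hD : Z + (NME.initial s f A Q).B - ((NME.initial s f A Q).Q - W) =
      Z + W - NME.redR s f A Q := by
    rw [NME.redR]; abel
  have hpos := NME.sub_posSemidef hZ hW
  have hlt : (Z + W - NME.redR s f A Q).PosDef ↔
      NME.specRadius (Z⁻¹ * (NME.initial s f A Q).A) < 1 :=
    ⟨NME.specRadius_lt_one_of_sub_posDef hZ hW, NME.sub_posDef_of_specRadius_lt_one hZ hW⟩
  have hle := hZ.specRadius_le_one
  have hone : ¬ IsUnit (Z + W - NME.redR s f A Q) ↔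
      NME.specRadius (Z⁻¹ * (NME.initial s f A Q).A) = 1 := by
    rw [← hpos.posDef_iff_isUnit, hlt, not_lt]
    exact ⟨fun h => le_antisymm hle h, fun h => h.ge⟩
  rw [hT, hS, hD]
  simp only [NME.iter_eq hZ hW]
  refine ⟨⟨?_, ?_⟩, NME.spec_eq hZ hW, hle, NME.specRadius_mul_le_one hZ hW, hlt,
    hlt.symm.trans (NME.specRadius_mul_lt_one_iff hZ hW).symm, ?_,
    fun _ => ⟨hone, hone.symm.trans (NME.one_mem_spec_mul_iff hZ hW).symm,
      NME.finrank_ker_sub_eq hZ hW⟩, ⟨hf.isUnit_map hQp.isUnit, fun k => ?_⟩,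
    hZ.tendsto.add_const _, hW.tendsto.const_sub _, fun N _ => ?_⟩
  · rw [add_sub_cancel_right]; exact hZ.posDef.isUnit
  · rw [sub_sub_cancel]; exact hW.posDef.isUnit
  · rintro rfl
    have := (NME.maxSol_minus hf hQp (hA rfl) hZ).2.2
    exact ⟨hlt.2 this, this⟩
  · rw [sub_sub_cancel]; exact (hW.fpi_posDef k).isUnit
  obtain ⟨cA, hcA, hAk⟩ := NME.exists_le_coup hZ hW N
  obtain ⟨cQ, hcQ, hQk⟩ := NME.exists_le_fpi_sub hZ hW N
  obtain ⟨cB, hcB, hBk⟩ := NME.exists_le_fpi_dual_sub hZ hW N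
  have hQk' : ∀ k, N (NME.fpi (NME.initial s f A Q).A (NME.redR s f A Q) k +
      (NME.initial s f A Q).B - (Z + (NME.initial s f A Q).B)) ≤
      cQ * NME.entryNorm ((Z⁻¹ * (NME.initial s f A Q).A) ^ (k + 1)) ^ 2 := fun k => by
    rw [add_sub_add_right_eq_sub]; exact hQk k
  have hBk' : ∀ k, N (((NME.initial s f A Q).Q -
      NME.fpi (NME.initial s f A Q).Aᴴ (NME.redR s f A Q) k) -
        ((NME.initial s f A Q).Q - W)) ≤
      cB * NME.entryNorm ((W⁻¹ * (NME.initial s f A Q).Aᴴ) ^ (k + 1)) ^ 2 := fun k => by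
    rw [sub_sub_sub_cancel_left, map_sub_rev]; exact hBk k
  have hBk'' : ∀ k, N ((Q - ((NME.initial s f A Q).Q -
      NME.fpi (NME.initial s f A Q).Aᴴ (NME.redR s f A Q) k)) -
        (Q - ((NME.initial s f A Q).Q - W))) ≤
      cB * NME.entryNorm ((W⁻¹ * (NME.initial s f A Q).Aᴴ) ^ (k + 1)) ^ 2 := fun k => by
    rw [sub_sub_sub_cancel_left, sub_sub_sub_cancel_left]; exact hBk k
  have hdual := NME.specRadius_dual_eq hZ hW
  refine ⟨fun h => ⟨?_, ?_, ?_⟩, ?_, ?_, ?_⟩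
  · exact NME.rLinear_of_le one_ne_zero hcA h fun k => by rw [sub_zero]; exact hAk k
  · exact NME.rLinear_of_le two_ne_zero hcQ h hQk'
  · exact NME.rLinear_of_le two_ne_zero hcB (hdual.trans_lt h) hBk'
  · exact (NME.rootRate_le one_ne_zero hcA hAk).trans_eq (pow_one _)
  · exact NME.rootRate_le two_ne_zero hcQ hQk'
  · rw [← hdual]
    exact NME.rootRate_le two_ne_zero hcB hBk''
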